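/- Let $\mathbb T=\mathbb R/\mathbb Z$ and fix a Knudsen number $\kappa>0$. For $u\in\mathbb R$ and $T>0$ let $\mathcal M_{u,T}(v)=(2\pi T)^{-1/2}e^{-(v-u)^2/(2T)}$ and $\mathcal M_T=\mathcal M_{0,T}$. For $f=f(x,v)\ge 0$ on $\mathbb T\times\mathbb R$ put $\rho_f=\int_{\mathbb R} f\,dv$, $\rho_f u_f=\int_{\mathbb R} v f\,dv$, and define $T_f$ by $\int_{\mathbb R} v^2 f\,dv=\rho_f\,(T_f+u_f^2)$. For $\alpha\in[0,1]$ and a measurable function $\tau:\mathbb T\to(0,\infty)$, a steady state of the nonlinear BGK equation $$\partial_t f+v\,\partial_x f=\frac1\kappa\Big(\rho_f\big(\alpha\,\mathcal M_{u_f,T_f}+(1-\alpha)\,\mathcal M_{\tau(x)}\big)-f\Big)$$ is a probability density $g$ on $\mathbb T\times\mathbb R$ with finite energy $\iint v^2 g\,dx\,dv<\infty$ that is a time-independent solution of this equation in the sense of distributions; steady states are identified when they agree almost everywhere. There is $\tau_0>0$, depending only on $\kappa$, such that for all $\tau_0\le\underline\tau\le\bar\tau$ there is $\alpha_0\in(0,1]$,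 depending only on $\kappa,\underline\tau,\bar\tau$, such that for every $\alpha\in[0,\alpha_0]$ there are constants $0<\underline T\le\bar T$, depending only on $\kappa,\alpha,\underline\tau,\bar\tau$, with the following property. For every measurable $\tau:\mathbb T\to\mathbb R$ with $\underline\tau\le\tau(x)\le\bar\tau$ for all $x\in\mathbb T$ there exists a steady state $g$ whose temperature profile satisfies $$\underline T\le \frac{\int_{\mathbb R} v^2 g(x,v)\,dv}{\int_{\mathbb R} g(x,v)\,dv}\le\bar T\qquad\text{for all }x\in\mathbb T,$$ and $g$ is the only steady state whose temperature profile satisfies these bounds (for almost every $x$). -/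

import Mathlib

open MeasureTheory
open scoped ContDiff

namespace BGK

/-- The Maxwellian with bulk velocity `u` and temperature `T`. -/
noncomputable def maxwellian (u T v : ℝ) : ℝ :=
  (Real.sqrt (2 * Real.pi * T))⁻¹ * Real.exp (-(v - u) ^ 2 / (2 * T))

/-- Spatial density `ρ_f(x) = ∫ f(x,v) dv`. -/
noncomputable def density (f : UnitAddCircle → ℝ → ℝ) (x : UnitAddCircle) : ℝ :=
  ∫ v : ℝ, f x v

/-- Bulk velocity: `ρ_f(x) u_f(x) = ∫ v f(x,v) dv`. -/
noncomputable def bulkVelocity (f : UnitAddCircle → ℝ → ℝ) (x : UnitAddCircle) : ℝ :=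
  (∫ v : ℝ, v * f x v) / density f x

/-- Pressure `P_f(x) = ∫ v² f(x,v) dv`. -/
noncomputable def pressure (f : UnitAddCircle → ℝ → ℝ) (x : UnitAddCircle) : ℝ :=
  ∫ v : ℝ, v ^ 2 * f x v

/-- Local temperature, given by `P_f = ρ_f (T_f + u_f²)`; it enters the nonlinear collision
operator. -/
noncomputable def localTemperature (f : UnitAddCircle → ℝ → ℝ) (x : UnitAddCircle) : ℝ :=
  pressure f x / density f x - bulkVelocity f x ^ 2

/-- The temperature profile `∫ v² g dv / ∫ g dv` of a steady state. For steady states of finite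
energy with `α < 1` the bulk velocity vanishes, and this is the local temperature. -/
noncomputable def temperatureProfile (g : UnitAddCircle → ℝ → ℝ) (x : UnitAddCircle) : ℝ :=
  pressure g x / density g x

/-- The right-hand side `(1/κ) (ρ_f (α M_{u_f,T_f} + (1-α) M_{0,τ(x)}) - f)` of the
nonlinear BGK equation coupled to the thermostat `τ`. -/
noncomputable def collision (κ α : ℝ) (τ : UnitAddCircle → ℝ) (f : UnitAddCircle → ℝ → ℝ)
    (x : UnitAddCircle) (v : ℝ) : ℝ :=
  (1 / κ) * (density f x *
    (α * maxwellian (bulkVelocity f x) (localTemperature f x) v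
      + (1 - α) * maxwellian 0 (τ x) v) - f x v)

/-- Test functions on the phase space `𝕋 × ℝ`: smooth (that is, the periodic lift to `ℝ × ℝ` is
smooth) with compact support. -/
structure IsTestFunction (φ : UnitAddCircle × ℝ → ℝ) : Prop where
  smooth : ContDiff ℝ ∞ (fun p : ℝ × ℝ => φ ((p.1 : UnitAddCircle), p.2))
  compactSupport : HasCompactSupport φ

/-- The partial derivative in the space variable of a function on `𝕋 × ℝ`. -/
noncomputable def dx (φ : UnitAddCircle × ℝ → ℝ) (x : UnitAddCircle) (v : ℝ) : ℝ :=
  deriv (fun s : ℝ => φ (x + (s : UnitAddCircle), v)) 0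

/-- `g` is a steady state: a probability density on `𝕋 × ℝ` with finite energy that solves
`v ∂ₓ g = (1/κ) (ρ_g (α M_{u_g,T_g} + (1-α) M_{τ(x)}) - g)` in the sense of distributions. -/
structure IsSteadyState (κ α : ℝ) (τ : UnitAddCircle → ℝ) (g : UnitAddCircle → ℝ → ℝ) :
    Prop where
  nonneg : ∀ᵐ p : UnitAddCircle × ℝ, 0 ≤ g p.1 p.2
  integrable : Integrable (fun p : UnitAddCircle × ℝ => g p.1 p.2)
  mass_one : ∫ p : UnitAddCircle × ℝ, g p.1 p.2 = 1
  finite_energy : Integrable (fun p : UnitAddCircle × ℝ => p.2 ^ 2 * g p.1 p.2)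
  weak_eq : ∀ φ : UnitAddCircle × ℝ → ℝ, IsTestFunction φ →
    ∫ p : UnitAddCircle × ℝ,
      (p.2 * g p.1 p.2 * dx φ p.1 p.2 + collision κ α τ g p.1 p.2 * φ p) = 0

end BGK

namespace BGK

open ProbabilityTheory

/-! ### Maxwellians -/

/-! A steady state is determined by its spatial density `ρ` alone. Mass conservation makes the flux
constant in `x`. The collision term keeps only the fraction `α < 1` of the momentum, so averaging
the momentum balance gives zero total flux, hence zero flux everywhere. The momentum balance then
says that the pressure `P` is constant (`ModeEq.flux_pressure`), and the averaged energy balance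
gives `P = ∫ ρ τ`. So the temperature is `temp τ ρ = P / ρ`, the gain term is the explicit function
`src α τ ρ`, and `g` is the unique periodic solution `mild κ (src α τ ρ)` of a linear transport
equation. Steady states with controlled temperature thus correspond to fixed points of `next κ α τ`,
the density of that solution (`IsSteadyState.identification`, `exists_steadyState`).

This map contracts in `L¹` for small `α`. The difference of two images is a combination, with
weights `α` and `1 - α`, of a local-Maxwellian part and a thermostat part. The first is Lipschitz as
long as temperatures stay in a fixed interval `[T₁, T₂]` with `T₁ > 0`
(`integral_abs_temp_part_sub_le`). The second is a linear Markov operator with a Doeblin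
minorization, so it shrinks differences of probability densities by the factor `1 - doeblin`
(`integral_abs_mild_thermostat_le`). If `α` times the Lipschitz constant is at most `doeblin / 2`,
the total factor is at most `1 - doeblin / 2`.

For existence one needs a closed set that the map preserves. The minorization bounds the new density
from below. For the upper bound, slow particles contribute little because they fill a small velocity
interval, and fast ones are spread by the transport kernel (`next_bounds`). Densities in `[a, b]`
have temperatures in `[τ₁ / b, τ₂ / a]`, so Banach's theorem applies. The contraction estimate uses
only temperature bounds, never density bounds, and for this reason uniqueness holds in the whole
class of steady states described by temperature bounds. -/

lemma maxwellian_nonneg (u T v : ℝ) : 0 ≤ maxwellian u T v := by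
  unfold maxwellian; positivity

lemma measurable_maxwellian : Measurable fun p : ℝ × ℝ × ℝ => maxwellian p.1 p.2.1 p.2.2 := by
  unfold maxwellian; fun_prop

lemma maxwellian_eq_gaussianPDFReal {T : ℝ} (hT : 0 < T) (u : ℝ) :
    maxwellian u T = gaussianPDFReal u T.toNNReal := by
  ext v; simp only [maxwellian, gaussianPDFReal, Real.coe_toNNReal _ hT.le]

lemma var_ne_zero {T : ℝ} (hT : 0 < T) : T.toNNReal ≠ 0 := (Real.toNNReal_pos.2 hT).ne'

lemma integrable_maxwellian {T : ℝ} (hT : 0 < T) (u : ℝ) : Integrable (maxwellian u T) := by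
  rw [maxwellian_eq_gaussianPDFReal hT]; exact integrable_gaussianPDFReal _ _

lemma integral_maxwellian {T : ℝ} (hT : 0 < T) (u : ℝ) : ∫ v, maxwellian u T v = 1 := by
  rw [maxwellian_eq_gaussianPDFReal hT]; exact integral_gaussianPDFReal_eq_one _ (var_ne_zero hT)

lemma integrable_mul_maxwellian_iff {T : ℝ} (hT : 0 < T) (u : ℝ) (f : ℝ → ℝ) :
    Integrable (fun v => f v * maxwellian u T v) ↔ Integrable f (gaussianReal u T.toNNReal) := by
  rw [gaussianReal_of_var_ne_zero _ (var_ne_zero hT),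
    integrable_withDensity_iff (measurable_gaussianPDF _ _) (by simp [gaussianPDF_lt_top])]
  simp only [toReal_gaussianPDF, maxwellian_eq_gaussianPDFReal hT]

lemma integral_mul_maxwellian {T : ℝ} (hT : 0 < T) (u : ℝ) (f : ℝ → ℝ) :
    ∫ v, f v * maxwellian u T v = ∫ v, f v ∂(gaussianReal u T.toNNReal) := by
  rw [integral_gaussianReal_eq_integral_smul (var_ne_zero hT)]
  simp only [smul_eq_mul, maxwellian_eq_gaussianPDFReal hT, mul_comm]

lemma memLp_id_two (u : ℝ) (V : NNReal) : MemLp (fun v : ℝ => v) 2 (gaussianReal u V) :=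
  memLp_id_gaussianReal 2

lemma integrable_id_mul_maxwellian {T : ℝ} (hT : 0 < T) (u : ℝ) :
    Integrable (fun v => v * maxwellian u T v) :=
  (integrable_mul_maxwellian_iff hT u _).2 ((memLp_id_two _ _).integrable (by norm_num))

lemma integrable_sq_mul_maxwellian {T : ℝ} (hT : 0 < T) (u : ℝ) :
    Integrable (fun v => v ^ 2 * maxwellian u T v) :=
  (integrable_mul_maxwellian_iff hT u _).2 (memLp_id_two _ _).integrable_sq

lemma integral_id_mul_maxwellian {T : ℝ} (hT : 0 < T) (u : ℝ) :
    ∫ v, v * maxwellian u T v = u := by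
  rw [integral_mul_maxwellian hT, integral_id_gaussianReal]

lemma integral_sq_mul_maxwellian {T : ℝ} (hT : 0 < T) (u : ℝ) :
    ∫ v, v ^ 2 * maxwellian u T v = T + u ^ 2 := by
  rw [integral_mul_maxwellian hT]
  have h := variance_eq_sub (memLp_id_two u T.toNNReal)
  rw [variance_fun_id_gaussianReal, integral_id_gaussianReal, Real.coe_toNNReal _ hT.le] at h
  have h' : T = _ := h
  simp only [Pi.pow_apply] at h'
  linarith

lemma maxwellian_le {T₁ T₂ T : ℝ} (h₁ : 0 < T₁) (hT : T₁ ≤ T) (hT' : T ≤ T₂) (v : ℝ) :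
    maxwellian 0 T v ≤ (Real.sqrt (2 * Real.pi * T₁))⁻¹ * Real.exp (-v ^ 2 / (2 * T₂)) := by
  unfold maxwellian
  have h0 : 0 < T := h₁.trans_le hT
  have : -(v - 0) ^ 2 / (2 * T) ≤ -v ^ 2 / (2 * T₂) := by
    rw [sub_zero, neg_div, neg_div, neg_le_neg_iff]; gcongr
  have h3 : 0 < 2 * Real.pi * T₁ := by positivity
  gcongr

lemma le_maxwellian {T₁ T₂ T : ℝ} (h₁ : 0 < T₁) (hT : T₁ ≤ T) (hT' : T ≤ T₂) (v : ℝ) :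
    (Real.sqrt (2 * Real.pi * T₂))⁻¹ * Real.exp (-v ^ 2 / (2 * T₁)) ≤ maxwellian 0 T v := by
  unfold maxwellian
  have h0 : 0 < T := h₁.trans_le hT
  have : -v ^ 2 / (2 * T₁) ≤ -(v - 0) ^ 2 / (2 * T) := by
    rw [sub_zero, neg_div, neg_div, neg_le_neg_iff]; gcongr
  have h3 : 0 < 2 * Real.pi * T := by positivity
  gcongr

/-- A common Gaussian majorant of the Maxwellians with temperature in `[T₁, T₂]`. -/
noncomputable def envelope (T₁ T₂ v : ℝ) : ℝ :=
  (Real.sqrt (2 * Real.pi * T₁))⁻¹ * Real.exp (-v ^ 2 / (2 * T₂))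

lemma envelope_eq {T₁ T₂ : ℝ} (h₂ : 0 < T₂) (v : ℝ) : envelope T₁ T₂ v =
    (Real.sqrt (2 * Real.pi * T₁))⁻¹ * Real.sqrt (2 * Real.pi * T₂) * maxwellian 0 T₂ v := by
  unfold envelope maxwellian
  have : Real.sqrt (2 * Real.pi * T₂) ≠ 0 := by positivity
  field_simp
  simp

lemma envelope_pos {T₁ T₂ : ℝ} (h₁ : 0 < T₁) (v : ℝ) : 0 < envelope T₁ T₂ v := by
  unfold envelope; positivity

lemma integrable_envelope {T₁ T₂ : ℝ} (h₂ : 0 < T₂) : Integrable (envelope T₁ T₂) := by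
  rw [funext (envelope_eq h₂)]; exact (integrable_maxwellian h₂ 0).const_mul _

lemma integrable_sq_mul_envelope {T₁ T₂ : ℝ} (h₂ : 0 < T₂) :
    Integrable fun v => v ^ 2 * envelope T₁ T₂ v := by
  have h := (integrable_sq_mul_maxwellian h₂ 0).const_mul
    ((Real.sqrt (2 * Real.pi * T₁))⁻¹ * Real.sqrt (2 * Real.pi * T₂))
  refine h.congr (ae_of_all _ fun v => ?_)
  simp only [envelope_eq h₂]; ring

/-- The derivative of the Maxwellian with respect to the temperature. -/
lemma hasDerivAt_maxwellian {T : ℝ} (hT : 0 < T) (v : ℝ) :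
    HasDerivAt (fun T => maxwellian 0 T v)
      (maxwellian 0 T v * (v ^ 2 / (2 * T ^ 2) - 1 / (2 * T))) T := by
  unfold maxwellian
  have h1 : HasDerivAt (fun T : ℝ => Real.sqrt (2 * Real.pi * T))
      (1 / (2 * Real.sqrt (2 * Real.pi * T)) * (2 * Real.pi * 1)) T :=
    (Real.hasDerivAt_sqrt (by positivity)).comp T ((hasDerivAt_id T).const_mul _)
  have h2 := h1.inv (by positivity)
  have h3 : HasDerivAt (fun T : ℝ => -(v - 0) ^ 2 / (2 * T))
      (-(-(v - 0) ^ 2 * (2 * 1)) / (2 * T) ^ 2) T := by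
    have := (((hasDerivAt_id T).const_mul 2).inv (by positivity : 2 * id T ≠ 0)).const_mul
      (-(v - 0) ^ 2)
    refine this.congr_deriv ?_
    simp only [id]; ring
  refine (h2.mul h3.exp).congr_deriv ?_
  have hs : Real.sqrt (2 * Real.pi * T) ^ 2 = 2 * Real.pi * T := Real.sq_sqrt (by positivity)
  have hs0 : Real.sqrt (2 * Real.pi * T) ≠ 0 := by positivity
  simp only [sub_zero, Pi.inv_apply]
  have hpi := Real.pi_pos
  generalize Real.sqrt (2 * Real.pi * T) = s at *
  have : T = s ^ 2 / (2 * Real.pi) := by rw [hs]; field_simp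
  generalize Real.exp _ = E
  have e1 : -(1 / (2 * s) * (2 * Real.pi * 1)) / s ^ 2 = s⁻¹ * (-(1 / (2 * T))) := by
    rw [this]; field_simp
  rw [e1]
  field_simp
  ring

/-- A common majorant of the temperature derivatives of Maxwellians with temperature in
`[T₁, T₂]`. -/
noncomputable def derivEnvelope (T₁ T₂ v : ℝ) : ℝ :=
  envelope T₁ T₂ v * (v ^ 2 / (2 * T₁ ^ 2) + 1 / (2 * T₁))

lemma derivEnvelope_nonneg {T₁ T₂ : ℝ} (h₁ : 0 < T₁) (v : ℝ) : 0 ≤ derivEnvelope T₁ T₂ v := by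
  have := envelope_pos (T₂ := T₂) h₁ v
  unfold derivEnvelope; positivity

lemma integrable_derivEnvelope {T₁ T₂ : ℝ} (h₂ : 0 < T₂) : Integrable (derivEnvelope T₁ T₂) := by
  have h := ((integrable_sq_mul_envelope (T₁ := T₁) h₂).const_mul (1 / (2 * T₁ ^ 2))).add
    ((integrable_envelope (T₁ := T₁) h₂).const_mul (1 / (2 * T₁)))
  refine h.congr (ae_of_all _ fun v => ?_)
  simp only [derivEnvelope, Pi.add_apply]; ring

/-- Mean value inequality in the temperature. The majorant does not depend on the temperatures, so
it can be integrated over `v` afterwards. -/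
lemma abs_maxwellian_sub_le {T₁ T₂ S T : ℝ} (h₁ : 0 < T₁) (hS : S ∈ Set.Icc T₁ T₂)
    (hT : T ∈ Set.Icc T₁ T₂) (v : ℝ) :
    |maxwellian 0 S v - maxwellian 0 T v| ≤ derivEnvelope T₁ T₂ v * |S - T| := by
  refine (convex_Icc T₁ T₂).norm_image_sub_le_of_norm_hasDerivWithin_le
    (f := fun T => maxwellian 0 T v)
    (fun R hR => (hasDerivAt_maxwellian (h₁.trans_le hR.1) v).hasDerivWithinAt)
    (fun R hR => ?_) hT hS
  have hR0 := h₁.trans_le hR.1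
  rw [Real.norm_eq_abs, abs_mul, abs_of_nonneg (maxwellian_nonneg _ _ _), derivEnvelope]
  have h2 : |v ^ 2 / (2 * R ^ 2) - 1 / (2 * R)| ≤ v ^ 2 / (2 * T₁ ^ 2) + 1 / (2 * T₁) := by
    refine (abs_sub _ _).trans ?_
    rw [abs_of_nonneg (by positivity), abs_of_nonneg (by positivity)]
    have := hR.1
    gcongr
  exact mul_le_mul (maxwellian_le h₁ hR.1 hR.2 v) h2 (abs_nonneg _) (envelope_pos h₁ v).le

end BGK

namespace BGK

/-! ### The periodic Green function of `w⁻¹ ∂ₓ + 1` -/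

/-- The periodic Green function of the operator `w⁻¹ ∂ₓ + 1` on the circle. -/
noncomputable def kern (w : ℝ) (x : UnitAddCircle) : ℝ :=
  w / (1 - Real.exp (-w)) * Real.exp (-w * (AddCircle.equivIco 1 0 x : ℝ))

lemma measurable_equivIco : Measurable fun x : UnitAddCircle => (AddCircle.equivIco 1 0 x : ℝ) :=
  measurable_subtype_coe.comp (AddCircle.measurableEquivIco 1 0).measurable

lemma measurable_kern : Measurable fun p : ℝ × UnitAddCircle => kern p.1 p.2 := by
  have : Measurable fun p : ℝ × UnitAddCircle => (AddCircle.equivIco 1 0 p.2 : ℝ) :=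
    measurable_equivIco.comp measurable_snd
  unfold kern
  fun_prop

lemma equivIco_mem (x : UnitAddCircle) :
    0 ≤ (AddCircle.equivIco 1 0 x : ℝ) ∧ (AddCircle.equivIco 1 0 x : ℝ) ≤ 1 := by
  have := (AddCircle.equivIco (1 : ℝ) 0 x).2
  exact ⟨this.1, by linarith [this.2]⟩

lemma kern_neg_eq (u : ℝ) (x : UnitAddCircle) : kern (-u) x =
    u / (Real.exp u - 1) * Real.exp (u * (AddCircle.equivIco 1 0 x : ℝ)) := by
  unfold kern
  rw [neg_neg, ← neg_sub (Real.exp u) 1, neg_div_neg_eq]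

/-- With `w = 1 / (κ v)` this degenerates as `v → 0`; it serves only for velocities bounded away
from zero. The sign of `w` is the direction of motion, and one formula covers both. -/
lemma kern_le (w : ℝ) (x : UnitAddCircle) : kern w x ≤ 1 + |w| := by
  obtain ⟨hs, hs'⟩ := equivIco_mem x
  rcases lt_trichotomy w 0 with hw | rfl | hw
  · obtain ⟨u, rfl⟩ : ∃ u, w = -u := ⟨-w, by ring⟩
    have hu : 0 < u := by linarith
    rw [kern_neg_eq u, abs_neg, abs_of_pos hu]
    have h1 : 0 < Real.exp u - 1 := by linarith [Real.add_one_lt_exp hu.ne']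
    have h2 : Real.exp (u * (AddCircle.equivIco 1 0 x : ℝ)) ≤ Real.exp u := by
      apply Real.exp_le_exp.2; nlinarith
    calc _ ≤ u / (Real.exp u - 1) * Real.exp u := by gcongr
      _ ≤ 1 + u := by
        rw [div_mul_eq_mul_div, div_le_iff₀ h1]
        nlinarith [Real.add_one_lt_exp hu.ne']
  · simp [kern]
  · rw [abs_of_pos hw, kern]
    have h1 : 0 < 1 - Real.exp (-w) := by
      have := Real.exp_lt_one_iff.2 (neg_lt_zero.2 hw); linarith
    have h2 : Real.exp (-w * (AddCircle.equivIco 1 0 x : ℝ)) ≤ 1 := by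
      apply Real.exp_le_one_iff.2; nlinarith
    calc _ ≤ w / (1 - Real.exp (-w)) * 1 := by gcongr
      _ ≤ 1 + w := by
        rw [mul_one, div_le_iff₀ h1]
        have h3 := Real.add_one_lt_exp hw.ne'
        have h4 : Real.exp w * Real.exp (-w) = 1 := by rw [← Real.exp_add]; simp
        nlinarith [Real.exp_pos (-w)]

/-- Every point of the circle is reached from every other within one period, with attenuation at
most `exp (-|w|)`. This positivity is the source of the Doeblin minorization. At `w = 0` the
convention `0 / 0 = 0` makes `kern` vanish. -/
lemma le_kern {w : ℝ} (hw : w ≠ 0) (x : UnitAddCircle) : Real.exp (-|w|) ≤ kern w x := by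
  obtain ⟨hs, hs'⟩ := equivIco_mem x
  rcases hw.lt_or_gt with hw | hw
  · obtain ⟨u, rfl⟩ : ∃ u, w = -u := ⟨-w, by ring⟩
    have hu : 0 < u := by linarith
    rw [kern_neg_eq u, abs_neg, abs_of_pos hu]
    have h1 : 0 < Real.exp u - 1 := by linarith [Real.add_one_lt_exp hu.ne']
    have h2 : 1 ≤ Real.exp (u * (AddCircle.equivIco 1 0 x : ℝ)) := by
      apply Real.one_le_exp; positivity
    calc _ ≤ u / (Real.exp u - 1) * 1 := by
          rw [mul_one, le_div_iff₀ h1]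
          have h4 : Real.exp (-u) * Real.exp u = 1 := by rw [← Real.exp_add]; simp
          nlinarith [Real.add_one_le_exp (-u)]
      _ ≤ _ := by gcongr
  · rw [abs_of_pos hw, kern]
    have h1 : 0 < 1 - Real.exp (-w) := by
      have := Real.exp_lt_one_iff.2 (neg_lt_zero.2 hw); linarith
    have h2 : Real.exp (-w) ≤ Real.exp (-w * (AddCircle.equivIco 1 0 x : ℝ)) := by
      apply Real.exp_le_exp.2; nlinarith
    calc _ ≤ 1 * Real.exp (-w * (AddCircle.equivIco 1 0 x : ℝ)) := by rwa [one_mul]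
      _ ≤ _ := by
        gcongr
        rw [le_div_iff₀ h1]
        linarith [Real.add_one_le_exp (-w)]

lemma kern_nonneg (w : ℝ) (x : UnitAddCircle) : 0 ≤ kern w x := by
  rcases eq_or_ne w 0 with rfl | hw
  · simp [kern]
  · exact (Real.exp_pos _).le.trans (le_kern hw x)

section Green

variable {E : Type*} [NormedAddCommGroup E] [NormedSpace ℝ E] [CompleteSpace E]

/-- The integrand is the derivative of `exp (-w s) ψ s` up to the prefactor of `kern`; integration
over a period gives `(exp (-w) - 1) ψ 0`, and the prefactor turns this into `-w ψ 0`. Values in `E`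
allow both real test functions and complex Fourier modes. -/
lemma integral_kern_smul_zero {w : ℝ} (hw : w ≠ 0) {ψ ψ' : UnitAddCircle → E}
    (hψ : ∀ s : ℝ, HasDerivAt (fun s : ℝ => ψ s) (ψ' s) s) (hψ' : Continuous ψ') :
    ∫ x, kern w x • (ψ' x - w • ψ x) = -w • ψ 0 := by
  have hw1 : 1 - Real.exp (-w) ≠ 0 := by
    rw [sub_ne_zero, ne_comm, Ne, Real.exp_eq_one_iff, neg_eq_zero]; exact hw
  rw [← UnitAddCircle.intervalIntegral_preimage 0]
  have hcongr : ∫ s in (0 : ℝ)..0 + 1, kern w s • (ψ' s - w • ψ s)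
      = ∫ s in (0 : ℝ)..0 + 1, (w / (1 - Real.exp (-w))) •
        (Real.exp (-w * s) • (ψ' s) + (Real.exp (-w * s) * -w) • ψ s) := by
    refine intervalIntegral.integral_congr_Ioo_of_le (by norm_num) fun s hs => ?_
    have hs' : s ∈ Set.Ico (0 : ℝ) (0 + 1) := ⟨hs.1.le, hs.2⟩
    simp only [kern, AddCircle.equivIco_coe_of_mem hs']
    module
  rw [hcongr, intervalIntegral.integral_smul]
  have hψc : Continuous fun s : ℝ => ψ s :=
    continuous_iff_continuousAt.2 fun s => (hψ s).continuousAt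
  have hψc' : Continuous fun s : ℝ => ψ' s := hψ'.comp (AddCircle.continuous_mk' 1)
  have hftc := intervalIntegral.integral_eq_sub_of_hasDerivAt (a := 0) (b := 0 + 1)
    (f := fun s : ℝ => Real.exp (-w * s) • ψ s)
    (f' := fun s : ℝ => Real.exp (-w * s) • (ψ' s) + (Real.exp (-w * s) * -w) • ψ s)
    (fun s _ => by
      have h1 : HasDerivAt (fun s : ℝ => Real.exp (-w * s)) (Real.exp (-w * s) * -w) s := by
        simpa using ((hasDerivAt_id s).const_mul (-w)).exp
      exact h1.smul (hψ s))
    (Continuous.intervalIntegrable (Continuous.add (Continuous.smul (by fun_prop) hψc')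
      (Continuous.smul (by fun_prop) hψc)) _ _)
  rw [hftc]
  have h01 : ((1 : ℝ) : UnitAddCircle) = 0 := AddCircle.coe_period 1
  simp only [mul_zero, Real.exp_zero, zero_add, mul_one, QuotientAddGroup.mk_zero, h01]
  rw [← sub_smul, smul_smul]
  congr 1
  field_simp
  ring

lemma integral_kern_smul {w : ℝ} (hw : w ≠ 0) {ψ ψ' : UnitAddCircle → E}
    (hψ : ∀ s : ℝ, HasDerivAt (fun s : ℝ => ψ s) (ψ' s) s) (hψ' : Continuous ψ')
    (y : UnitAddCircle) :
    ∫ x, kern w (x - y) • (ψ' x - w • ψ x) = -w • ψ y := by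
  rw [← integral_add_right_eq_self _ y]
  simp only [add_sub_cancel_right]
  obtain ⟨t, rfl⟩ := QuotientAddGroup.mk_surjective y
  have := integral_kern_smul_zero hw (ψ := fun x => ψ (x + (t : UnitAddCircle)))
    (ψ' := fun x => ψ' (x + (t : UnitAddCircle)))
    (fun s => by
      have := HasDerivAt.comp_add_const s t (hψ (s + t))
      simpa only [AddCircle.coe_add] using this)
    (by fun_prop)
  simpa only [zero_add] using this

end Green

lemma integral_kern {w : ℝ} (hw : w ≠ 0) (y : UnitAddCircle) : ∫ x, kern w (x - y) = 1 := by
  have := integral_kern_smul (E := ℝ) hw (ψ := fun _ => 1) (ψ' := fun _ => 0)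
    (fun s => hasDerivAt_const s 1) continuous_const y
  simp only [smul_eq_mul, mul_one, zero_sub, integral_mul_const] at this
  have h2 : (∫ x, kern w (x - y)) * -w = 1 * -w := by linarith
  exact mul_right_cancel₀ (neg_ne_zero.2 hw) h2

lemma integrable_kern_mul (w : ℝ) (x : UnitAddCircle) {q : UnitAddCircle → ℝ}
    (hq : Integrable q) : Integrable fun y => kern w (x - y) * q y := by
  refine hq.bdd_mul (c := 1 + |w|) ?_ (ae_of_all _ fun y => ?_)
  · exact (measurable_kern.comp (f := fun y => (w, x - y)) (by fun_prop)).aestronglyMeasurable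
  · rw [Real.norm_eq_abs, abs_of_nonneg (kern_nonneg _ _)]; exact kern_le _ _

lemma integrable_kern_sub (w : ℝ) (y : UnitAddCircle) : Integrable fun x => kern w (x - y) := by
  refine (integrable_const (1 + |w|)).mono' ?_ (ae_of_all _ fun x => ?_)
  · exact (measurable_kern.comp (f := fun x => (w, x - y)) (by fun_prop)).aestronglyMeasurable
  · rw [Real.norm_eq_abs, abs_of_nonneg (kern_nonneg _ _)]; exact kern_le _ _

lemma integral_kern_left {w : ℝ} (hw : w ≠ 0) (x : UnitAddCircle) : ∫ y, kern w (x - y) = 1 := by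
  have := integral_sub_left_eq_self (fun y => kern w y) volume x
  rw [this]
  simpa using integral_kern hw 0

/-! ### Solutions of the linear transport equation with given source -/

/-- The periodic solution `g` of `v ∂ₓ g = (q - g) / κ`. -/
noncomputable def mild (κ : ℝ) (q : UnitAddCircle → ℝ → ℝ) (x : UnitAddCircle) (v : ℝ) : ℝ :=
  ∫ y, kern (1 / (κ * v)) (x - y) * q y v

lemma mild_const_mul (κ : ℝ) (r : ℝ → ℝ) (q : UnitAddCircle → ℝ → ℝ) (x : UnitAddCircle) (v : ℝ) :
    mild κ (fun x v => r v * q x v) x v = r v * mild κ q x v := by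
  unfold mild
  rw [← integral_const_mul]
  congr 1 with y
  ring

lemma mild_nonneg (κ : ℝ) {q : UnitAddCircle → ℝ → ℝ} {v : ℝ} (hq : ∀ᵐ y, 0 ≤ q y v)
    (x : UnitAddCircle) : 0 ≤ mild κ q x v :=
  integral_nonneg_of_ae (hq.mono fun _ hy => mul_nonneg (kern_nonneg _ _) hy)

lemma mild_congr (κ : ℝ) {q q' : UnitAddCircle → ℝ → ℝ} {v : ℝ} (hq : ∀ᵐ y, q y v = q' y v)
    (x : UnitAddCircle) : mild κ q x v = mild κ q' x v :=
  integral_congr_ae (hq.mono fun _ hy => by simp only [hy])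

lemma ae_velocity_ne_zero : ∀ᵐ v : ℝ, v ≠ 0 := by
  simp [ae_iff]

lemma one_div_mul_ne_zero {κ v : ℝ} (hκ : 0 < κ) (hv : v ≠ 0) : 1 / (κ * v) ≠ 0 := by
  have := hκ.ne'; positivity

section Section

variable {E : Type*} [NormedAddCommGroup E] [NormedSpace ℝ E] [CompleteSpace E]

/-- Fubini's theorem for the pairing of `mild κ q (·, v)` with a continuous function. -/
lemma integral_mild_smul (κ : ℝ) {q : UnitAddCircle → ℝ → ℝ} {v : ℝ}
    (hq : Integrable fun x => q x v) {ξ : UnitAddCircle → E} (hξ : Continuous ξ) :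
    ∫ x, mild κ q x v • ξ x = ∫ y, q y v • ∫ x, kern (1 / (κ * v)) (x - y) • ξ x := by
  set w := 1 / (κ * v)
  obtain ⟨C, hC⟩ := isCompact_univ.exists_bound_of_continuousOn hξ.continuousOn
  have hint : Integrable (fun z : UnitAddCircle × UnitAddCircle =>
      (kern w (z.1 - z.2) * q z.2 v) • ξ z.1) (volume.prod volume) := by
    have h1 : Integrable (fun z : UnitAddCircle × UnitAddCircle => q z.2 v)
        (volume.prod volume) := hq.comp_snd volume
    have h2 : AEStronglyMeasurable (fun z : UnitAddCircle × UnitAddCircle =>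
        kern w (z.1 - z.2)) (volume.prod volume) :=
      (measurable_kern.comp (f := fun z : UnitAddCircle × UnitAddCircle => (w, z.1 - z.2))
        (by fun_prop)).aestronglyMeasurable
    have h3 : AEStronglyMeasurable (fun z : UnitAddCircle × UnitAddCircle => ξ z.1)
        (volume.prod volume) := (hξ.comp continuous_fst).aestronglyMeasurable
    have h4 : Integrable (fun z : UnitAddCircle × UnitAddCircle => (1 + |w|) * C * ‖q z.2 v‖)
        (volume.prod volume) := h1.norm.const_mul _
    refine h4.mono' ((h2.mul h1.1).smul h3) (ae_of_all _ fun z => ?_)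
    rw [norm_smul, norm_mul, Real.norm_of_nonneg (kern_nonneg _ _)]
    calc kern w (z.1 - z.2) * ‖q z.2 v‖ * ‖ξ z.1‖
        ≤ (1 + |w|) * ‖q z.2 v‖ * C := by
          gcongr
          · exact kern_le _ _
          · exact hC _ (Set.mem_univ _)
      _ = _ := by ring
  calc ∫ x, mild κ q x v • ξ x
      = ∫ x, ∫ y, (kern w (x - y) * q y v) • ξ x := by
        simp only [mild, integral_smul_const, w]
    _ = ∫ y, ∫ x, (kern w (x - y) * q y v) • ξ x := integral_integral_swap hint
    _ = _ := by
        congr 1 with y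
        rw [← integral_smul]
        congr 1 with x
        rw [smul_smul, mul_comm]

/-- Weak form of `κ v ∂ₓ g + g = q` at a fixed velocity, from Fubini and the Green identity. Taking
`ψ` to be `1`, a Fourier mode or a section of a test function gives conservation of mass, `ModeEq`
and the distributional equation. -/
lemma integral_mild_smul_sub {κ : ℝ} (hκ : 0 < κ) {q : UnitAddCircle → ℝ → ℝ} {v : ℝ}
    (hv : v ≠ 0) (hq : Integrable fun x => q x v) {ψ ψ' : UnitAddCircle → E}
    (hψ : ∀ s : ℝ, HasDerivAt (fun s : ℝ => ψ s) (ψ' s) s) (hψc : Continuous ψ)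
    (hψ' : Continuous ψ') :
    ∫ x, mild κ q x v • ((κ * v) • ψ' x - ψ x) = - ∫ x, q x v • ψ x := by
  have hw := one_div_mul_ne_zero hκ hv
  have hκv : κ * v ≠ 0 := by have := hκ.ne'; positivity
  have h1 := integral_mild_smul κ hq (ξ := fun x => ψ' x - (1 / (κ * v)) • ψ x) (by fun_prop)
  simp only [integral_kern_smul hw hψ hψ'] at h1
  have h2 : ∀ x, mild κ q x v • ((κ * v) • ψ' x - ψ x)
      = (κ * v) • (mild κ q x v • (ψ' x - (1 / (κ * v)) • ψ x)) := fun x => by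
    rw [smul_comm (κ * v), smul_sub (κ * v), smul_smul (κ * v) (1 / (κ * v)),
      mul_one_div_cancel hκv, one_smul]
  simp only [h2]
  rw [integral_smul, h1, ← integral_smul, ← integral_neg]
  congr 1 with y
  rw [smul_comm, smul_smul (κ * v), mul_neg, mul_one_div_cancel hκv, neg_smul, one_smul, smul_neg]

end Section

lemma integral_mild_section {κ : ℝ} (hκ : 0 < κ) {q : UnitAddCircle → ℝ → ℝ} {v : ℝ}
    (hv : v ≠ 0) (hq : Integrable fun x => q x v) : ∫ x, mild κ q x v = ∫ x, q x v := by
  have := integral_mild_smul_sub (E := ℝ) hκ hv hq (ψ := fun _ => 1) (ψ' := fun _ => 0)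
    (fun s => hasDerivAt_const s 1) continuous_const continuous_const
  simp only [smul_eq_mul, mul_zero, zero_sub, mul_one, mul_neg, integral_neg, neg_inj] at this
  exact this

/-- The measure-preserving reordering `((y, v), x) ↦ ((x, v), y)`. -/
lemma measurePreserving_exchange : MeasurePreserving
    (fun z : (UnitAddCircle × ℝ) × UnitAddCircle => ((z.2, z.1.2), z.1.1)) volume volume := by
  have h1 : MeasurePreserving (Prod.swap : (UnitAddCircle × ℝ) × UnitAddCircle → _)
      (volume.prod volume) (volume.prod volume) := Measure.measurePreserving_swap
  have h2 : MeasurePreserving (Prod.map id Prod.swap :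
      UnitAddCircle × (UnitAddCircle × ℝ) → UnitAddCircle × (ℝ × UnitAddCircle))
      (volume.prod (volume.prod volume)) (volume.prod (volume.prod volume)) :=
    (MeasurePreserving.id _).prod Measure.measurePreserving_swap
  have h3 := (measurePreserving_prodAssoc (volume : Measure UnitAddCircle) (volume : Measure ℝ)
    (volume : Measure UnitAddCircle)).symm
  exact h3.comp (h2.comp h1)

/-- Integrating over the target point `x` first, the kernel has mass one and only `‖q‖` remains. The
order of variables is then exchanged to the one in which `mild` integrates. -/
lemma integrable_mild_integrand {κ : ℝ} (hκ : 0 < κ) {q : UnitAddCircle → ℝ → ℝ}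
    (hq : Integrable fun p : UnitAddCircle × ℝ => q p.1 p.2) :
    Integrable fun z : (UnitAddCircle × ℝ) × UnitAddCircle =>
      kern (1 / (κ * z.1.2)) (z.1.1 - z.2) * q z.2 z.1.2 := by
  have hmeas : AEStronglyMeasurable (fun z : (UnitAddCircle × ℝ) × UnitAddCircle =>
      kern (1 / (κ * z.1.2)) (z.2 - z.1.1) * q z.1.1 z.1.2)
      ((volume : Measure (UnitAddCircle × ℝ)).prod volume) := by
    have h1 := (hq.comp_fst (volume : Measure UnitAddCircle)).1
    have h2 : Measurable fun z : (UnitAddCircle × ℝ) × UnitAddCircle =>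
        kern (1 / (κ * z.1.2)) (z.2 - z.1.1) :=
      measurable_kern.comp (f := fun z : (UnitAddCircle × ℝ) × UnitAddCircle =>
        (1 / (κ * z.1.2), z.2 - z.1.1)) (by fun_prop)
    exact h2.aestronglyMeasurable.mul h1
  have hnorm : ∀ᵐ p : UnitAddCircle × ℝ, ‖q p.1 p.2‖ =
      ∫ x : UnitAddCircle, ‖kern (1 / (κ * p.2)) (x - p.1) * q p.1 p.2‖ := by
    have hv : ∀ᵐ p : UnitAddCircle × ℝ, p.2 ≠ 0 :=
      Measure.quasiMeasurePreserving_snd.ae ae_velocity_ne_zero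
    filter_upwards [hv] with p hp
    simp only [norm_mul, Real.norm_of_nonneg (kern_nonneg _ _), integral_mul_const,
      integral_kern (one_div_mul_ne_zero hκ hp), one_mul]
  have hsec : ∀ p : UnitAddCircle × ℝ, Integrable
      fun x : UnitAddCircle => kern (1 / (κ * p.2)) (x - p.1) * q p.1 p.2 :=
    fun p => (integrable_kern_sub (1 / (κ * p.2)) p.1).mul_const (q p.1 p.2)
  have hint : Integrable fun p : UnitAddCircle × ℝ =>
      ∫ x : UnitAddCircle, ‖kern (1 / (κ * p.2)) (x - p.1) * q p.1 p.2‖ :=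
    hq.norm.congr hnorm
  have h := (integrable_prod_iff hmeas).2 ⟨Filter.Eventually.of_forall hsec, hint⟩
  exact measurePreserving_exchange.integrable_comp_of_integrable h

lemma integrable_mild {κ : ℝ} (hκ : 0 < κ) {q : UnitAddCircle → ℝ → ℝ}
    (hq : Integrable fun p : UnitAddCircle × ℝ => q p.1 p.2) :
    Integrable fun p : UnitAddCircle × ℝ => mild κ q p.1 p.2 :=
  (integrable_mild_integrand hκ hq).integral_prod_left

lemma integral_mild {κ : ℝ} (hκ : 0 < κ) {q : UnitAddCircle → ℝ → ℝ}
    (hq : Integrable fun p : UnitAddCircle × ℝ => q p.1 p.2) :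
    ∫ p : UnitAddCircle × ℝ, mild κ q p.1 p.2 = ∫ p : UnitAddCircle × ℝ, q p.1 p.2 := by
  have h1 := integral_prod_symm _ (integrable_mild hκ hq)
  have h2 := integral_prod_symm _ hq
  refine h1.trans (Eq.trans ?_ h2.symm)
  refine integral_congr_ae ?_
  filter_upwards [ae_velocity_ne_zero, hq.prod_left_ae] with v hv hqv
  exact integral_mild_section hκ hv hqv

lemma integrable_mul_mild {κ : ℝ} (hκ : 0 < κ) {q : UnitAddCircle → ℝ → ℝ} {r : ℝ → ℝ}
    (hq : Integrable fun p : UnitAddCircle × ℝ => r p.2 * q p.1 p.2) :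
    Integrable fun p : UnitAddCircle × ℝ => r p.2 * mild κ q p.1 p.2 := by
  simpa only [mild_const_mul] using integrable_mild hκ (q := fun x v => r v * q x v) hq

lemma mild_sub (κ : ℝ) {q q' : UnitAddCircle → ℝ → ℝ} {v : ℝ}
    (hq : Integrable fun x => q x v) (hq' : Integrable fun x => q' x v) (x : UnitAddCircle) :
    mild κ (fun x v => q x v - q' x v) x v = mild κ q x v - mild κ q' x v := by
  unfold mild
  rw [← integral_sub (integrable_kern_mul _ _ hq) (integrable_kern_mul _ _ hq')]
  simp only [mul_sub]

lemma mild_add (κ : ℝ) {q q' : UnitAddCircle → ℝ → ℝ} {v : ℝ}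
    (hq : Integrable fun x => q x v) (hq' : Integrable fun x => q' x v) (x : UnitAddCircle) :
    mild κ (fun x v => q x v + q' x v) x v = mild κ q x v + mild κ q' x v := by
  unfold mild
  rw [← integral_add (integrable_kern_mul _ _ hq) (integrable_kern_mul _ _ hq')]
  simp only [mul_add]

lemma abs_mild_le (κ : ℝ) (q : UnitAddCircle → ℝ → ℝ) (x : UnitAddCircle) (v : ℝ) :
    |mild κ q x v| ≤ mild κ (fun x v => |q x v|) x v := by
  refine (abs_integral_le_integral_abs).trans_eq ?_
  simp only [abs_mul, abs_of_nonneg (kern_nonneg _ _), mild]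

lemma mild_mono (κ : ℝ) {q q' : UnitAddCircle → ℝ → ℝ} {v : ℝ} (hq : Integrable fun x => q x v)
    (hq' : Integrable fun x => q' x v) (h : ∀ᵐ y, q y v ≤ q' y v) (x : UnitAddCircle) :
    mild κ q x v ≤ mild κ q' x v :=
  integral_mono_ae (integrable_kern_mul _ _ hq) (integrable_kern_mul _ _ hq')
    (h.mono fun _ hy => mul_le_mul_of_nonneg_left hy (kern_nonneg _ _))

/-! ### Fourier modes -/

/-- The `n`-th Fourier mode on the circle. -/
noncomputable abbrev mode (n : ℤ) : C(UnitAddCircle, ℂ) := fourier n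

lemma hasDerivAt_mode (n : ℤ) (s : ℝ) : HasDerivAt (fun s : ℝ => mode n (s : UnitAddCircle))
    (2 * Real.pi * Complex.I * n * mode n s) s := by
  simpa using hasDerivAt_fourier (1 : ℝ) n s

lemma integrable_smul_mode {d : UnitAddCircle → ℝ} (hd : Integrable d) (n : ℤ) :
    Integrable fun x => d x • mode n x := by
  refine hd.norm.mono' (hd.1.smul (mode n).continuous.aestronglyMeasurable)
    (ae_of_all _ fun x => ?_)
  rw [norm_smul, fourier_apply, Circle.norm_coe, mul_one]

/-- The pairing with `d` is continuous in the sup norm, so its kernel is closed and contains the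
closed span of the modes, which is everything. -/
lemma integral_smul_continuous_eq_zero {d : UnitAddCircle → ℝ} (hd : Integrable d)
    (h : ∀ n, ∫ x, d x • mode n x = 0) (φ : C(UnitAddCircle, ℂ)) : ∫ x, d x • φ x = 0 := by
  have hint : ∀ φ : C(UnitAddCircle, ℂ), Integrable fun x => d x • φ x := fun φ => by
    refine (hd.norm.mul_const ‖φ‖).mono' (hd.1.smul φ.continuous.aestronglyMeasurable)
      (ae_of_all _ fun x => ?_)
    rw [norm_smul]
    gcongr
    exact φ.norm_coe_le_norm x
  let L : C(UnitAddCircle, ℂ) →ₗ[ℂ] ℂ :=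
    { toFun := fun φ => ∫ x, d x • φ x
      map_add' := fun φ χ => by
        simp only [ContinuousMap.add_apply, smul_add]
        exact integral_add (hint φ) (hint χ)
      map_smul' := fun c φ => by
        simp only [ContinuousMap.smul_apply, RingHom.id_apply]
        rw [← integral_smul]
        congr 1 with x
        exact smul_comm _ _ _ }
  have hL : Continuous L := by
    refine (L.mkContinuous (∫ x, ‖d x‖) fun φ => ?_).continuous
    refine (norm_integral_le_integral_norm _).trans ?_
    rw [← integral_mul_const]
    refine integral_mono (hint φ).norm (hd.norm.mul_const _) fun x => ?_
    simp only [norm_smul]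
    gcongr
    exact φ.norm_coe_le_norm x
  have hker : (LinearMap.ker L).topologicalClosure = LinearMap.ker L :=
    ((isClosed_singleton (x := (0 : ℂ))).preimage hL).submodule_topologicalClosure_eq
  have hle : Submodule.span ℂ (Set.range (fourier (T := 1))) ≤ LinearMap.ker L := by
    rw [Submodule.span_le]
    rintro _ ⟨n, rfl⟩
    exact h n
  have htop := span_fourier_closure_eq_top (T := 1)
  have : φ ∈ LinearMap.ker L := by
    rw [← hker]
    exact Submodule.topologicalClosure_mono hle (htop ▸ Submodule.mem_top)
  exact this

/-- An integrable function on the circle with vanishing Fourier coefficients vanishes. -/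
lemma ae_eq_zero_of_mode {d : UnitAddCircle → ℝ} (hd : Integrable d)
    (h : ∀ n, ∫ x, d x • mode n x = 0) : ∀ᵐ x, d x = 0 := by
  have hfin : ∀ f : UnitAddCircle → ℝ, Integrable f →
      IsFiniteMeasure (volume.withDensity fun x => ENNReal.ofReal (f x)) := fun f hf =>
    isFiniteMeasure_withDensity_ofReal hf.2
  have h1 := hfin d hd
  have h2 := hfin (fun x => -d x) hd.neg
  have hmeas : ∀ f : UnitAddCircle → ℝ, Integrable f →
      AEMeasurable (fun x => (f x).toNNReal) := fun f hf => hf.1.aemeasurable.real_toNNReal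
  have hpart : ∀ f : UnitAddCircle → ℝ, Integrable f →
      ∀ φ : BoundedContinuousFunction UnitAddCircle ℝ, Integrable fun x => ((f x).toNNReal : ℝ) * φ x := by
    intro f hf φ
    refine (hf.norm.mul_const ‖φ‖).mono' ?_ (ae_of_all _ fun x => ?_)
    · exact ((hmeas f hf).coe_nnreal_real.aestronglyMeasurable).mul
        φ.continuous.aestronglyMeasurable
    · rw [norm_mul]
      refine mul_le_mul ?_ (φ.norm_coe_le_norm x) (norm_nonneg _) (norm_nonneg _)
      rw [Real.coe_toNNReal', Real.norm_of_nonneg (le_max_right _ _)]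
      exact max_le (le_abs_self _) (abs_nonneg _)
  -- As `d` is only in `L¹`, the `L²` theory of Fourier series does not apply. Instead the positive
  -- and negative parts of `d` are densities of finite measures, and these agree because they
  -- integrate continuous functions alike.
  have hext : (volume.withDensity fun x => ENNReal.ofReal (d x))
      = volume.withDensity fun x => ENNReal.ofReal (-d x) := by
    refine ext_of_forall_integral_eq_of_IsFiniteMeasure fun φ => ?_
    have e1 := integral_withDensity_eq_integral_smul₀ (hmeas d hd) φ
    have e2 := integral_withDensity_eq_integral_smul₀ (hmeas _ hd.neg) φ
    refine (e1.trans (sub_eq_zero.1 ?_)).trans e2.symm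
    simp only [NNReal.smul_def, smul_eq_mul]
    rw [← integral_sub (hpart d hd φ) (hpart _ hd.neg φ)]
    have h0 := integral_smul_continuous_eq_zero hd h
      ⟨fun x => (φ x : ℂ), Complex.continuous_ofReal.comp φ.continuous⟩
    simp only [ContinuousMap.coe_mk, Complex.real_smul] at h0
    rw [← Complex.ofReal_inj, ← integral_complex_ofReal, Complex.ofReal_zero, ← h0]
    congr 1 with x
    simp only [Real.coe_toNNReal', Pi.neg_apply]
    rw [← sub_mul, ← Complex.ofReal_mul]
    congr 2
    rcases le_total 0 (d x) with hx | hx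
    · rw [max_eq_left hx, max_eq_right (by linarith)]; ring
    · rw [max_eq_right hx, max_eq_left (by linarith)]; ring
  rw [withDensity_eq_iff (g := fun x => ENNReal.ofReal (-d x)) hd.1.aemeasurable.ennreal_ofReal hd.1.aemeasurable.neg.ennreal_ofReal
    (by
      have := h1.measure_univ_lt_top
      rw [withDensity_apply _ MeasurableSet.univ, Measure.restrict_univ] at this
      exact this.ne)] at hext
  filter_upwards [hext] with x hx
  rcases le_total 0 (d x) with h0 | h0
  · rw [ENNReal.ofReal_of_nonpos (by linarith : -d x ≤ 0), ENNReal.ofReal_eq_zero] at hx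
    linarith
  · rw [ENNReal.ofReal_of_nonpos h0, eq_comm, ENNReal.ofReal_eq_zero] at hx
    linarith

lemma integral_mode {n : ℤ} (hn : n ≠ 0) : ∫ x, mode n x = 0 :=
  integral_eq_zero_of_add_right_eq_neg (μ := volume)
    (fourier_add_half_inv_index hn one_pos)

lemma ae_eq_integral_of_mode {d : UnitAddCircle → ℝ} (hd : Integrable d)
    (h : ∀ n ≠ 0, ∫ x, d x • mode n x = 0) : ∀ᵐ x, d x = ∫ y, d y := by
  have := ae_eq_zero_of_mode (d := fun x => d x - ∫ y, d y) (hd.sub (integrable_const _))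
    fun n => by
      simp only [sub_smul]
      rw [integral_sub (integrable_smul_mode hd n) (integrable_smul_mode (integrable_const _) n),
        integral_smul]
      rcases eq_or_ne n 0 with rfl | hn
      · simp [integral_complex_ofReal, Measure.real]
      · rw [h n hn, integral_mode hn, smul_zero, sub_zero]
  filter_upwards [this] with x hx
  linarith

/-! ### The stationary transport equation in Fourier variables -/

/-- The stationary transport equation `v ∂ₓ g = (q - g) / κ`, Fourier transformed in space. -/
def ModeEq (κ : ℝ) (g q : UnitAddCircle → ℝ → ℝ) : Prop :=
  ∀ n : ℤ, ∀ᵐ v : ℝ, ∫ x, q x v • mode n x =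
    (1 - κ * v * (2 * Real.pi * Complex.I * n)) * ∫ x, g x v • mode n x

lemma mode_factor_ne_zero (κ v : ℝ) (n : ℤ) :
    (1 - κ * v * (2 * Real.pi * Complex.I * n) : ℂ) ≠ 0 := by
  intro h
  have := congrArg Complex.re h
  simp at this

lemma modeEq_mild {κ : ℝ} (hκ : 0 < κ) {q : UnitAddCircle → ℝ → ℝ}
    (hq : Integrable fun p : UnitAddCircle × ℝ => q p.1 p.2) : ModeEq κ (mild κ q) q := by
  intro n
  filter_upwards [ae_velocity_ne_zero, hq.prod_left_ae] with v hv hqv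
  have h := integral_mild_smul_sub hκ hv hqv (ψ := mode n)
    (ψ' := fun x => 2 * Real.pi * Complex.I * n * mode n x)
    (hasDerivAt_mode n) (mode n).continuous (by fun_prop)
  rw [← neg_eq_iff_eq_neg] at h
  rw [← h, ← integral_const_mul, ← integral_neg]
  congr 1 with x
  simp only [Complex.real_smul]
  push_cast
  ring

lemma ae_ae_of_sections {f : UnitAddCircle × ℝ → ℝ} (hf : Integrable f)
    (h : ∀ᵐ v : ℝ, ∀ᵐ x : UnitAddCircle, f (x, v) = 0) : ∀ᵐ p, f p = 0 := by
  have h1 : ∫ p, ‖f p‖ = 0 := by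
    refine (integral_prod_symm _ hf.norm).trans ?_
    refine integral_eq_zero_of_ae (h.mono fun v hv => ?_)
    exact integral_eq_zero_of_ae (hv.mono fun x hx => by simp [hx])
  rw [integral_eq_zero_iff_of_nonneg (fun _ => norm_nonneg _) hf.norm] at h1
  exact h1.mono fun p hp => norm_eq_zero.1 hp

/-- The factor `1 - 2πi κ v n` has real part one, so the source determines every Fourier coefficient
of the solution. -/
lemma ModeEq.unique {κ : ℝ} {g g' q : UnitAddCircle → ℝ → ℝ}
    (hg : Integrable fun p : UnitAddCircle × ℝ => g p.1 p.2)
    (hg' : Integrable fun p : UnitAddCircle × ℝ => g' p.1 p.2)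
    (h : ModeEq κ g q) (h' : ModeEq κ g' q) :
    ∀ᵐ p : UnitAddCircle × ℝ, g p.1 p.2 = g' p.1 p.2 := by
  have := ae_ae_of_sections (f := fun p => g p.1 p.2 - g' p.1 p.2) (hg.sub hg') (by
    filter_upwards [hg.prod_left_ae, hg'.prod_left_ae, ae_all_iff.2 h, ae_all_iff.2 h']
      with v h1 h2 h3 h4
    refine ae_eq_zero_of_mode (h1.sub h2) fun n => ?_
    simp only [sub_smul]
    rw [integral_sub (integrable_smul_mode h1 n) (integrable_smul_mode h2 n), sub_eq_zero]
    exact mul_left_cancel₀ (mode_factor_ne_zero κ v n) ((h3 n).symm.trans (h4 n)))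
  exact this.mono fun p hp => sub_eq_zero.1 hp

lemma integral_mode_swap {f : UnitAddCircle → ℝ → ℝ} {r : ℝ → ℝ}
    (hf : Integrable fun p : UnitAddCircle × ℝ => r p.2 * f p.1 p.2) (n : ℤ) :
    Integrable (fun v => r v • ∫ x, f x v • mode n x) ∧
    ∫ v, r v • ∫ x, f x v • mode n x = ∫ x, (∫ v, r v * f x v) • mode n x := by
  have hint : Integrable (fun p : UnitAddCircle × ℝ => (r p.2 * f p.1 p.2) • mode n p.1)
      (volume.prod volume) := by
    refine hf.norm.mono' (hf.1.smul ((mode n).continuous.comp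
      continuous_fst).aestronglyMeasurable) (ae_of_all _ fun p => ?_)
    rw [norm_smul]
    rw [fourier_apply, Circle.norm_coe, mul_one]
  have hr : ∀ v, r v • ∫ x, f x v • mode n x = ∫ x, (r v * f x v) • mode n x := fun v => by
    rw [← integral_smul]
    simp only [smul_smul]
  simp only [hr, ← integral_smul_const]
  exact ⟨hint.integral_prod_right, (integral_integral_swap hint).symm⟩

/-- The hierarchy of moment equations: transport multiplies the weight by `v`, hence the
integrability assumption on `v r(v) g`. -/
lemma ModeEq.moment {κ : ℝ} {g q : UnitAddCircle → ℝ → ℝ} (h : ModeEq κ g q) {r : ℝ → ℝ}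
    (hq : Integrable fun p : UnitAddCircle × ℝ => r p.2 * q p.1 p.2)
    (hg : Integrable fun p : UnitAddCircle × ℝ => r p.2 * g p.1 p.2)
    (hg' : Integrable fun p : UnitAddCircle × ℝ => (p.2 * r p.2) * g p.1 p.2) (n : ℤ) :
    ∫ x, (∫ v, r v * q x v) • mode n x = (∫ x, (∫ v, r v * g x v) • mode n x) -
      κ * (2 * Real.pi * Complex.I * n) * ∫ x, (∫ v, (v * r v) * g x v) • mode n x := by
  obtain ⟨_, e1⟩ := integral_mode_swap hq n
  obtain ⟨i2, e2⟩ := integral_mode_swap hg n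
  obtain ⟨i3, e3⟩ := integral_mode_swap (r := fun v => v * r v) hg' n
  rw [← e1, ← e2, ← e3, ← integral_const_mul, ← integral_sub i2 (i3.const_mul _)]
  refine integral_congr_ae ((h n).mono fun v hv => ?_)
  beta_reduce
  rw [hv]
  simp only [Complex.real_smul]
  push_cast
  ring

/-- For the mean value the transport term is absent, so the energy balance `r = v ^ 2` needs no
third moment. -/
lemma ModeEq.moment_zero {κ : ℝ} {g q : UnitAddCircle → ℝ → ℝ} (h : ModeEq κ g q) {r : ℝ → ℝ}
    (hq : Integrable fun p : UnitAddCircle × ℝ => r p.2 * q p.1 p.2)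
    (hg : Integrable fun p : UnitAddCircle × ℝ => r p.2 * g p.1 p.2) :
    ∫ x, ∫ v, r v * q x v = ∫ x, ∫ v, r v * g x v := by
  obtain ⟨_, e1⟩ := integral_mode_swap hq 0
  obtain ⟨_, e2⟩ := integral_mode_swap hg 0
  have : ∫ x, (∫ v, r v * q x v) • mode 0 x = ∫ x, (∫ v, r v * g x v) • mode 0 x := by
    rw [← e1, ← e2]
    refine integral_congr_ae ((h 0).mono fun v hv => ?_)
    simp only [hv, Int.cast_zero, mul_zero, sub_zero, one_mul]
  simpa [integral_complex_ofReal] using this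

lemma integrable_id_mul_of_sq {g : UnitAddCircle × ℝ → ℝ} (hg : Integrable g)
    (hg2 : Integrable fun p : UnitAddCircle × ℝ => p.2 ^ 2 * g p) :
    Integrable fun p : UnitAddCircle × ℝ => p.2 * g p := by
  refine (hg.norm.add hg2.norm).mono' (measurable_snd.aestronglyMeasurable.mul hg.1)
    (ae_of_all _ fun p => ?_)
  simp only [Pi.add_apply, norm_mul, norm_pow]
  have : ‖p.2‖ ≤ 1 + ‖p.2‖ ^ 2 := by nlinarith [sq_nonneg (‖p.2‖ - 1)]
  nlinarith [norm_nonneg (g p)]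

/-- If the source conserves mass and contracts momentum, then the flux vanishes and the pressure
is constant. -/
lemma ModeEq.flux_pressure {κ : ℝ} (hκ : 0 < κ) {g q : UnitAddCircle → ℝ → ℝ} (h : ModeEq κ g q)
    (hg : Integrable fun p : UnitAddCircle × ℝ => g p.1 p.2)
    (hg2 : Integrable fun p : UnitAddCircle × ℝ => p.2 ^ 2 * g p.1 p.2)
    (hq : Integrable fun p : UnitAddCircle × ℝ => q p.1 p.2)
    (hq2 : Integrable fun p : UnitAddCircle × ℝ => p.2 ^ 2 * q p.1 p.2)
    (hmass : ∀ᵐ x, ∫ v, q x v = ∫ v, g x v) {β : ℝ} (hβ : β ≠ 1)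
    (hmom : ∀ᵐ x, ∫ v, v * q x v = β * ∫ v, v * g x v) :
    (∀ᵐ x, ∫ v, v * g x v = 0) ∧ ∀ᵐ x, ∫ v, v ^ 2 * g x v = ∫ y, ∫ v, v ^ 2 * q y v := by
  have hg1 := integrable_id_mul_of_sq hg hg2
  have hq1 := integrable_id_mul_of_sq hq hq2
  have hfac : ∀ n : ℤ, n ≠ 0 → (κ * (2 * Real.pi * Complex.I * n) : ℂ) ≠ 0 := fun n hn => by
    have := hκ.ne'
    have := Real.pi_ne_zero
    have := Complex.I_ne_zero
    have : (n : ℂ) ≠ 0 := by exact_mod_cast hn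
    simp_all
  -- Mass balance: the nonzero modes of the flux vanish, so the flux is constant.
  have hj := ae_eq_integral_of_mode (d := fun x => ∫ v, v * g x v) hg1.integral_prod_left
    fun n hn => by
      have e := h.moment (r := fun _ => 1) (by simpa using hq) (by simpa using hg)
        (by simpa using hg1) n
      simp only [one_mul, mul_one] at e
      have e' : ∫ x, (∫ v, q x v) • mode n x = ∫ x, (∫ v, g x v) • mode n x :=
        integral_congr_ae (hmass.mono fun x hx => by simp only [hx])
      rw [e', eq_comm, sub_eq_self] at e
      exact (mul_eq_zero.1 e).resolve_left (hfac n hn)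
  -- Averaged momentum balance: the total flux equals `β` times itself.
  have hj0 : ∫ x, ∫ v, v * g x v = 0 := by
    have e := h.moment_zero (r := fun v => v) hq1 hg1
    rw [integral_congr_ae hmom, integral_const_mul] at e
    have : (β - 1) * ∫ x, ∫ v, v * g x v = 0 := by linarith
    exact (mul_eq_zero.1 this).resolve_left (sub_ne_zero.2 hβ)
  rw [hj0] at hj
  refine ⟨hj, ?_⟩
  -- In the momentum balance only the pressure gradient is left.
  have hP := ae_eq_integral_of_mode (d := fun x => ∫ v, v ^ 2 * g x v) hg2.integral_prod_left
    fun n hn => by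
      have e := h.moment (r := fun v => v) hq1 hg1 (by simpa only [sq] using hg2) n
      have e1 : ∫ x, (∫ v, v * q x v) • mode n x = 0 :=
        integral_eq_zero_of_ae (by
          filter_upwards [hmom, hj] with x hx hx'
          rw [hx, hx', mul_zero, zero_smul]; rfl)
      have e2 : ∫ x, (∫ v, v * g x v) • mode n x = 0 :=
        integral_eq_zero_of_ae (by
          filter_upwards [hj] with x hx'
          rw [hx', zero_smul]; rfl)
      rw [e1, e2, zero_sub, zero_eq_neg] at e
      simpa only [sq] using (mul_eq_zero.1 e).resolve_left (hfac n hn)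
  rwa [← h.moment_zero (r := fun v => v ^ 2) hq2 hg2] at hP

instance isProbabilityMeasure_circle : IsProbabilityMeasure (volume : Measure UnitAddCircle) :=
  ⟨UnitAddCircle.measure_univ⟩

/-! ### Local Maxwellian sources -/

section Source

variable {ρ u θ : UnitAddCircle → ℝ}

lemma aestronglyMeasurable_mul_maxwellian (hρ : AEStronglyMeasurable ρ) (hu : AEMeasurable u)
    (hθ : AEMeasurable θ) : AEStronglyMeasurable
      (fun p : UnitAddCircle × ℝ => ρ p.1 * maxwellian (u p.1) (θ p.1) p.2)
      (volume.prod volume) := by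
  refine (hρ.comp_fst).mul ?_
  have hq : Measure.QuasiMeasurePreserving (Prod.fst : UnitAddCircle × ℝ → UnitAddCircle)
      (volume.prod volume) volume := Measure.quasiMeasurePreserving_fst
  have h1 : AEMeasurable (fun p : UnitAddCircle × ℝ => (u p.1, θ p.1, p.2))
      (volume.prod volume) :=
    (hu.comp_quasiMeasurePreserving hq).prodMk
      ((hθ.comp_quasiMeasurePreserving hq).prodMk measurable_snd.aemeasurable)
  exact (measurable_maxwellian.comp_aemeasurable h1).aestronglyMeasurable

lemma integrable_mul_maxwellian (hρ : Integrable ρ) (hu : AEMeasurable u) (hθ : AEMeasurable θ)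
    (hpos : ∀ᵐ x, 0 < θ x) :
    Integrable fun p : UnitAddCircle × ℝ => ρ p.1 * maxwellian (u p.1) (θ p.1) p.2 := by
  refine (integrable_prod_iff (aestronglyMeasurable_mul_maxwellian hρ.1 hu hθ)).2 ⟨?_, ?_⟩
  · refine hpos.mono fun x hx => ?_
    change Integrable fun v => ρ x * maxwellian (u x) (θ x) v
    exact (integrable_maxwellian hx _).const_mul _
  · refine hρ.norm.congr (hpos.mono fun x hx => ?_)
    simp only [norm_mul, Real.norm_of_nonneg (maxwellian_nonneg _ _ _), integral_const_mul,
      integral_maxwellian hx, mul_one]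

lemma integrable_sq_mul_mul_maxwellian (hρ : AEStronglyMeasurable ρ) (hu : AEMeasurable u)
    (hθ : AEMeasurable θ) (hpos : ∀ᵐ x, 0 < θ x)
    (h : Integrable fun x => ρ x * (θ x + u x ^ 2)) :
    Integrable fun p : UnitAddCircle × ℝ =>
      p.2 ^ 2 * (ρ p.1 * maxwellian (u p.1) (θ p.1) p.2) := by
  have hm := aestronglyMeasurable_mul_maxwellian hρ hu hθ
  have hm' : AEStronglyMeasurable (fun p : UnitAddCircle × ℝ =>
      p.2 ^ 2 * (ρ p.1 * maxwellian (u p.1) (θ p.1) p.2)) (volume.prod volume) :=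
    ((measurable_snd.pow_const 2).aestronglyMeasurable).mul hm
  have heq : ∀ x v, v ^ 2 * (ρ x * maxwellian (u x) (θ x) v)
      = ρ x * (v ^ 2 * maxwellian (u x) (θ x) v) := fun x v => by ring
  refine (integrable_prod_iff hm').2 ⟨?_, ?_⟩
  · refine hpos.mono fun x hx => ?_
    simp only [heq]
    exact (integrable_sq_mul_maxwellian hx _).const_mul _
  · refine h.norm.congr (hpos.mono fun x hx => ?_)
    have h0 : ∀ v, 0 ≤ v ^ 2 * maxwellian (u x) (θ x) v := fun v =>
      mul_nonneg (sq_nonneg _) (maxwellian_nonneg _ _ _)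
    simp only [heq, norm_mul (ρ x), Real.norm_of_nonneg (h0 _), integral_const_mul,
      integral_sq_mul_maxwellian hx]
    rw [Real.norm_of_nonneg (by positivity : 0 ≤ θ x + u x ^ 2)]

end Source

/-! ### The density map and its contraction in `L¹` -/

/-- The temperature belonging to the density `ρ` if the pressure is `∫ ρ τ`. -/
noncomputable def temp (τ ρ : UnitAddCircle → ℝ) (x : UnitAddCircle) : ℝ :=
  (∫ y, ρ y * τ y) / ρ x

/-- The gain term of the collision operator for a stationary density `ρ`. -/
noncomputable def src (α : ℝ) (τ ρ : UnitAddCircle → ℝ) (x : UnitAddCircle) (v : ℝ) : ℝ :=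
  ρ x * (α * maxwellian 0 (temp τ ρ x) v + (1 - α) * maxwellian 0 (τ x) v)

/-- The density of the solution of the transport equation with source `src α τ ρ`. -/
noncomputable def next (κ α : ℝ) (τ ρ : UnitAddCircle → ℝ) (x : UnitAddCircle) : ℝ :=
  ∫ v, mild κ (src α τ ρ) x v

/-- Probability densities on the circle whose temperature lies between `T₁` and `T₂`. -/
structure Admissible (τ : UnitAddCircle → ℝ) (T₁ T₂ : ℝ) (ρ : UnitAddCircle → ℝ) : Prop where
  integrable : Integrable ρ
  nonneg : ∀ᵐ x, 0 ≤ ρ x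
  integral_one : ∫ x, ρ x = 1
  temp_mem : ∀ᵐ x, temp τ ρ x ∈ Set.Icc T₁ T₂

/-- Measurable thermostat temperatures with values in `[τ₁, τ₂]`. -/
structure Thermostat (τ₁ τ₂ : ℝ) (τ : UnitAddCircle → ℝ) : Prop where
  measurable : Measurable τ
  mem : ∀ x, τ x ∈ Set.Icc τ₁ τ₂

section Estimates

variable {κ α τ₁ τ₂ T₁ T₂ : ℝ} {τ ρ ρ' : UnitAddCircle → ℝ}

lemma Thermostat.integrable_mul (hτ : Thermostat τ₁ τ₂ τ) (h0 : 0 < τ₁) (hρ : Integrable ρ) :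
    Integrable fun x => ρ x * τ x := by
  refine hρ.mul_bdd (c := τ₂) hτ.measurable.aestronglyMeasurable (ae_of_all _ fun x => ?_)
  rw [Real.norm_of_nonneg (h0.le.trans (hτ.mem x).1)]
  exact (hτ.mem x).2

lemma aemeasurable_temp (hρ : Integrable ρ) : AEMeasurable (temp τ ρ) :=
  aemeasurable_const.div hρ.1.aemeasurable

lemma Admissible.temp_pos (h : Admissible τ T₁ T₂ ρ) (h0 : 0 < T₁) : ∀ᵐ x, 0 < temp τ ρ x :=
  h.temp_mem.mono fun _ hx => h0.trans_le hx.1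

/-- A positive temperature excludes `ρ x = 0`, where the quotient would be zero by convention. The
constancy of the product replaces a lower bound on the density in later estimates. -/
lemma Admissible.mul_temp (h : Admissible τ T₁ T₂ ρ) (h0 : 0 < T₁) :
    ∀ᵐ x, ρ x * temp τ ρ x = ∫ y, ρ y * τ y := by
  filter_upwards [h.temp_pos h0] with x hx
  have : ρ x ≠ 0 := fun h => by simp [temp, h] at hx
  unfold temp
  field_simp

lemma Admissible.integrable_temp_part (h : Admissible τ T₁ T₂ ρ) (h0 : 0 < T₁) :
    Integrable fun p : UnitAddCircle × ℝ => ρ p.1 * maxwellian 0 (temp τ ρ p.1) p.2 :=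
  integrable_mul_maxwellian (u := fun _ => 0) h.integrable aemeasurable_const
    (aemeasurable_temp h.integrable) (h.temp_pos h0)

lemma Thermostat.integrable_part (hτ : Thermostat τ₁ τ₂ τ) (h0 : 0 < τ₁) (hρ : Integrable ρ) :
    Integrable fun p : UnitAddCircle × ℝ => ρ p.1 * maxwellian 0 (τ p.1) p.2 :=
  integrable_mul_maxwellian (u := fun _ => 0) hρ aemeasurable_const
    hτ.measurable.aemeasurable (ae_of_all _ fun x => h0.trans_le (hτ.mem x).1)

lemma src_eq (α : ℝ) (τ ρ : UnitAddCircle → ℝ) (x : UnitAddCircle) (v : ℝ) :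
    src α τ ρ x v = α * (ρ x * maxwellian 0 (temp τ ρ x) v)
      + (1 - α) * (ρ x * maxwellian 0 (τ x) v) := by
  unfold src; ring

lemma Admissible.integrable_src (h : Admissible τ T₁ T₂ ρ) (hT : 0 < T₁)
    (hτ : Thermostat τ₁ τ₂ τ) (h0 : 0 < τ₁) :
    Integrable fun p : UnitAddCircle × ℝ => src α τ ρ p.1 p.2 := by
  simp only [src_eq]
  exact ((h.integrable_temp_part hT).const_mul _).add
    ((hτ.integrable_part h0 h.integrable).const_mul _)

lemma Admissible.integrable_sq_src (h : Admissible τ T₁ T₂ ρ) (hT : 0 < T₁)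
    (hτ : Thermostat τ₁ τ₂ τ) (h0 : 0 < τ₁) :
    Integrable fun p : UnitAddCircle × ℝ => p.2 ^ 2 * src α τ ρ p.1 p.2 := by
  have h1 : Integrable fun p : UnitAddCircle × ℝ =>
      p.2 ^ 2 * (ρ p.1 * maxwellian 0 (temp τ ρ p.1) p.2) := by
    refine integrable_sq_mul_mul_maxwellian (u := fun _ => 0) h.integrable.1 aemeasurable_const
      (aemeasurable_temp h.integrable) (h.temp_pos hT) ?_
    refine (integrable_const (∫ y, ρ y * τ y)).congr ((h.mul_temp hT).mono fun x hx => ?_)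
    simp only [← hx]; ring
  have h2 : Integrable fun p : UnitAddCircle × ℝ =>
      p.2 ^ 2 * (ρ p.1 * maxwellian 0 (τ p.1) p.2) := by
    refine integrable_sq_mul_mul_maxwellian (u := fun _ => 0) h.integrable.1 aemeasurable_const
      hτ.measurable.aemeasurable (ae_of_all _ fun x => h0.trans_le (hτ.mem x).1) ?_
    simpa using hτ.integrable_mul h0 h.integrable
  refine ((h1.const_mul α).add (h2.const_mul (1 - α))).congr (ae_of_all _ fun p => ?_)
  simp only [src_eq, Pi.add_apply]; ring

lemma src_nonneg (hα : 0 ≤ α) (hα' : α ≤ 1) {x : UnitAddCircle} (hx : 0 ≤ ρ x) (v : ℝ) :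
    0 ≤ src α τ ρ x v := by
  unfold src
  have := maxwellian_nonneg 0 (temp τ ρ x) v
  have := maxwellian_nonneg 0 (τ x) v
  have := sub_nonneg.2 hα'
  positivity

lemma integral_abs_integral_le {F : UnitAddCircle → ℝ → ℝ}
    (hF : Integrable fun p : UnitAddCircle × ℝ => F p.1 p.2) :
    ∫ x, |∫ v, F x v| ≤ ∫ p : UnitAddCircle × ℝ, |F p.1 p.2| := by
  have h1 : ∫ p : UnitAddCircle × ℝ, |F p.1 p.2| = ∫ x, ∫ v, |F x v| :=
    integral_prod _ hF.abs
  rw [h1]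
  exact integral_mono hF.integral_prod_left.abs hF.abs.integral_prod_left
    fun x => abs_integral_le_integral_abs

lemma integral_abs_mild_le (hκ : 0 < κ) {q : UnitAddCircle → ℝ → ℝ}
    (hq : Integrable fun p : UnitAddCircle × ℝ => q p.1 p.2) :
    ∫ p : UnitAddCircle × ℝ, |mild κ q p.1 p.2| ≤ ∫ p : UnitAddCircle × ℝ, |q p.1 p.2| := by
  rw [← integral_mild hκ (q := fun x v => |q x v|) hq.abs]
  exact integral_mono (integrable_mild hκ hq).abs (integrable_mild hκ (q := fun x v => |q x v|)
    hq.abs) fun p => abs_mild_le _ _ _ _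

/-- The lower bound for the transition densities of the thermostat dynamics. -/
noncomputable def minorant (κ τ₁ τ₂ v : ℝ) : ℝ :=
  Real.exp (-|1 / (κ * v)|) * envelope τ₂ τ₁ v

/-- The Doeblin constant of the thermostat dynamics. -/
noncomputable def doeblin (κ τ₁ τ₂ : ℝ) : ℝ := ∫ v, minorant κ τ₁ τ₂ v

lemma minorant_pos (h : 0 < τ₂) (v : ℝ) : 0 < minorant κ τ₁ τ₂ v :=
  mul_pos (Real.exp_pos _) (envelope_pos h v)

/-- The bound is uniform in position and thermostat temperature. `envelope` with its temperatures
interchanged is a Gaussian minorant (`le_maxwellian`). -/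
lemma minorant_le (h₁ : 0 < τ₁) {T : ℝ} (hT : T ∈ Set.Icc τ₁ τ₂) {v : ℝ} (hκ : 0 < κ)
    (hv : v ≠ 0) (x : UnitAddCircle) :
    minorant κ τ₁ τ₂ v ≤ kern (1 / (κ * v)) x * maxwellian 0 T v :=
  mul_le_mul (le_kern (one_div_mul_ne_zero hκ hv) x) (le_maxwellian h₁ hT.1 hT.2 v)
    (envelope_pos (h₁.trans_le (hT.1.trans hT.2)) v).le (kern_nonneg _ _)

lemma minorant_le_maxwellian (h₁ : 0 < τ₁) (h : τ₁ ≤ τ₂) (v : ℝ) :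
    minorant κ τ₁ τ₂ v ≤ maxwellian 0 τ₁ v := by
  have h2 : Real.exp (-|1 / (κ * v)|) ≤ 1 := Real.exp_le_one_iff.2 (neg_nonpos.2 (abs_nonneg _))
  calc _ ≤ 1 * envelope τ₂ τ₁ v :=
        mul_le_mul_of_nonneg_right h2 (envelope_pos (h₁.trans_le h) v).le
    _ ≤ _ := by rw [one_mul]; exact le_maxwellian h₁ le_rfl h v

lemma integrable_minorant (h₁ : 0 < τ₁) (h : τ₁ ≤ τ₂) : Integrable (minorant κ τ₁ τ₂) := by
  refine (integrable_maxwellian h₁ 0).mono' ?_ (ae_of_all _ fun v => ?_)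
  · unfold minorant envelope
    exact Measurable.aestronglyMeasurable (by fun_prop)
  · rw [Real.norm_of_nonneg (minorant_pos (h₁.trans_le h) v).le]
    exact minorant_le_maxwellian h₁ h v

lemma doeblin_pos (h₁ : 0 < τ₁) (h : τ₁ ≤ τ₂) : 0 < doeblin κ τ₁ τ₂ := by
  unfold doeblin
  rw [integral_pos_iff_support_of_nonneg (fun v => (minorant_pos (h₁.trans_le h) v).le)
    (integrable_minorant h₁ h)]
  have : Function.support (minorant κ τ₁ τ₂) = Set.univ :=
    Set.eq_univ_of_forall fun v => (minorant_pos (h₁.trans_le h) v).ne'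
  simp [this]

lemma doeblin_le_one (h₁ : 0 < τ₁) (h : τ₁ ≤ τ₂) : doeblin κ τ₁ τ₂ ≤ 1 := by
  rw [← integral_maxwellian h₁ 0]
  exact integral_mono (integrable_minorant h₁ h) (integrable_maxwellian h₁ 0)
    (minorant_le_maxwellian h₁ h)

lemma Thermostat.integrable_section (hτ : Thermostat τ₁ τ₂ τ) (h₁ : 0 < τ₁)
    (hρ : Integrable ρ) (v : ℝ) : Integrable fun y => ρ y * maxwellian 0 (τ y) v := by
  refine hρ.mul_bdd (c := envelope τ₁ τ₂ v) ?_ (ae_of_all _ fun y => ?_)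
  · exact (measurable_maxwellian.comp (measurable_const.prodMk
      (hτ.measurable.prodMk measurable_const))).aestronglyMeasurable
  · rw [Real.norm_of_nonneg (maxwellian_nonneg _ _ _)]
    exact maxwellian_le h₁ (hτ.mem y).1 (hτ.mem y).2 v

/-- Doeblin's argument: as `δ` has mean zero, the minorant may be subtracted from the transition
kernel at no cost. What remains is nonnegative, so absolute values pass inside and the subtracted
mass is gained. -/
lemma abs_mild_thermostat_le (hκ : 0 < κ) (hτ : Thermostat τ₁ τ₂ τ) (h₁ : 0 < τ₁)
    {δ : UnitAddCircle → ℝ} (hδ : Integrable δ) (hδ0 : ∫ x, δ x = 0) {v : ℝ} (hv : v ≠ 0)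
    (x : UnitAddCircle) :
    |mild κ (fun x v => δ x * maxwellian 0 (τ x) v) x v| ≤
      mild κ (fun x v => |δ x| * maxwellian 0 (τ x) v) x v
        - minorant κ τ₁ τ₂ v * ∫ y, |δ y| := by
  have i1 := integrable_kern_mul (1 / (κ * v)) x (hτ.integrable_section h₁ hδ v)
  have i2 := integrable_kern_mul (1 / (κ * v)) x (hτ.integrable_section h₁ hδ.abs v)
  have e1 : mild κ (fun x v => δ x * maxwellian 0 (τ x) v) x v =
      ∫ y, (kern (1 / (κ * v)) (x - y) * maxwellian 0 (τ y) v - minorant κ τ₁ τ₂ v) * δ y := by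
    have : mild κ (fun x v => δ x * maxwellian 0 (τ x) v) x v =
        mild κ (fun x v => δ x * maxwellian 0 (τ x) v) x v -
          ∫ y, minorant κ τ₁ τ₂ v * δ y := by
      rw [integral_const_mul, hδ0, mul_zero, sub_zero]
    rw [this, mild, ← integral_sub i1 (hδ.const_mul _)]
    congr 1 with y
    ring
  rw [e1, mild, ← integral_const_mul, ← integral_sub i2 (hδ.abs.const_mul _)]
  refine abs_integral_le_integral_abs.trans_eq ?_
  congr 1 with y
  rw [abs_mul, abs_of_nonneg (sub_nonneg.2 (minorant_le h₁ (hτ.mem y) hκ hv (x - y)))]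
  ring

lemma integral_abs_mild_thermostat_le (hκ : 0 < κ) (hτ : Thermostat τ₁ τ₂ τ) (h₁ : 0 < τ₁)
    (h₁₂ : τ₁ ≤ τ₂) {δ : UnitAddCircle → ℝ} (hδ : Integrable δ) (hδ0 : ∫ x, δ x = 0) :
    ∫ p : UnitAddCircle × ℝ, |mild κ (fun x v => δ x * maxwellian 0 (τ x) v) p.1 p.2| ≤
      (1 - doeblin κ τ₁ τ₂) * ∫ y, |δ y| := by
  have i1 := integrable_mild hκ (q := fun x v => δ x * maxwellian 0 (τ x) v)
    (hτ.integrable_part h₁ hδ)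
  have j2 := hτ.integrable_part h₁ hδ.abs
  have i2 := integrable_mild hκ (q := fun x v => |δ x| * maxwellian 0 (τ x) v) j2
  have i3 : Integrable (fun p : UnitAddCircle × ℝ => minorant κ τ₁ τ₂ p.2 * ∫ y, |δ y|) :=
    ((integrable_minorant h₁ h₁₂).comp_snd volume).mul_const _
  have hv : ∀ᵐ p : UnitAddCircle × ℝ, p.2 ≠ 0 :=
    Measure.quasiMeasurePreserving_snd.ae ae_velocity_ne_zero
  have hle := integral_mono_ae i1.abs (i2.sub i3) (hv.mono fun p hp =>
    abs_mild_thermostat_le hκ hτ h₁ hδ hδ0 hp p.1)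
  refine hle.trans_eq ?_
  simp only [Pi.sub_apply]
  rw [integral_sub i2 i3, integral_mild hκ (q := fun x v => |δ x| * maxwellian 0 (τ x) v) j2,
    integral_mul_const]
  have e1 : ∫ p : UnitAddCircle × ℝ, |δ p.1| * maxwellian 0 (τ p.1) p.2 = ∫ y, |δ y| := by
    refine (integral_prod _ j2).trans ?_
    congr 1 with x
    simp only [integral_const_mul, integral_maxwellian (h₁.trans_le (hτ.mem x).1), mul_one]
  have e2 : ∫ p : UnitAddCircle × ℝ, minorant κ τ₁ τ₂ p.2 = doeblin κ τ₁ τ₂ := by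
    refine (integral_prod _ ((integrable_minorant h₁ h₁₂).comp_snd volume)).trans ?_
    simp [doeblin]
  rw [e1, e2]
  ring

/-- The Lipschitz constant of `ρ ↦ ρ M_{temp ρ}` in `L¹`. -/
noncomputable def lipConst (τ₂ T₁ T₂ : ℝ) : ℝ := (∫ v, derivEnvelope T₁ T₂ v) * (τ₂ + T₂) + 1

/-- The term `+ 1` in `lipConst` comes from varying the density at fixed temperature, the other term
from varying the temperature. -/
lemma integral_abs_temp_part_sub_le (hτ : Thermostat τ₁ τ₂ τ) (h₁ : 0 < τ₁) (hT₁ : 0 < T₁)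
    (h₁₂ : T₁ ≤ T₂) (h : Admissible τ T₁ T₂ ρ) (h' : Admissible τ T₁ T₂ ρ') :
    ∫ p : UnitAddCircle × ℝ, |ρ p.1 * maxwellian 0 (temp τ ρ p.1) p.2
        - ρ' p.1 * maxwellian 0 (temp τ ρ' p.1) p.2| ≤
      lipConst τ₂ T₁ T₂ * ∫ x, |ρ x - ρ' x| := by
  set D := ∫ x, |ρ x - ρ' x|
  set P := ∫ y, ρ y * τ y
  set P' := ∫ y, ρ' y * τ y
  have hδ : Integrable fun x => ρ x - ρ' x := h.integrable.sub h'.integrable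
  have hP : |P - P'| ≤ τ₂ * D := by
    simp only [P, P', D]
    rw [← integral_sub (hτ.integrable_mul h₁ h.integrable) (hτ.integrable_mul h₁ h'.integrable),
      ← integral_const_mul]
    refine abs_integral_le_integral_abs.trans (integral_mono ?_ (hδ.abs.const_mul _) fun x => ?_)
    · exact ((hτ.integrable_mul h₁ h.integrable).sub (hτ.integrable_mul h₁ h'.integrable)).abs
    · beta_reduce
      rw [← sub_mul, abs_mul, abs_of_nonneg (h₁.le.trans (hτ.mem x).1), mul_comm]
      exact mul_le_mul_of_nonneg_right (hτ.mem x).2 (abs_nonneg _)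
  have hT₂ := hT₁.trans_le h₁₂
  have hlift : ∀ {Q : UnitAddCircle → Prop}, (∀ᵐ x, Q x) → ∀ᵐ p : UnitAddCircle × ℝ, Q p.1 :=
    fun hQ => Measure.quasiMeasurePreserving_fst.ae hQ
  have j1 : Integrable (fun p : UnitAddCircle × ℝ =>
      (|P - P'| + T₂ * |ρ p.1 - ρ' p.1|) * derivEnvelope T₁ T₂ p.2) :=
    Integrable.mul_prod (f := fun x => |P - P'| + T₂ * |ρ x - ρ' x|)
      ((integrable_const _).add (hδ.abs.const_mul _)) (integrable_derivEnvelope hT₂)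
  have j2 : Integrable (fun p : UnitAddCircle × ℝ =>
      |ρ p.1 - ρ' p.1| * maxwellian 0 (temp τ ρ' p.1) p.2) :=
    integrable_mul_maxwellian (u := fun _ => 0) hδ.abs aemeasurable_const
      (aemeasurable_temp h'.integrable) (h'.temp_pos hT₁)
  have hle := integral_mono_ae ((h.integrable_temp_part hT₁).sub
    (h'.integrable_temp_part hT₁)).abs (j1.add j2) (by
      filter_upwards [hlift h.nonneg, hlift h.temp_mem, hlift h'.temp_mem,
        hlift (h.mul_temp hT₁), hlift (h'.mul_temp hT₁)] with p h0 hm hm' hP hP'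
      simp only [Pi.add_apply, Pi.sub_apply]
      set t := temp τ ρ p.1
      set t' := temp τ ρ' p.1
      have ht' : 0 ≤ t' := hT₁.le.trans hm'.1
      -- Since `ρ t = P` and `ρ' t' = P'`, the temperature difference weighted by `ρ` is linear in
      -- the differences of pressure and density. No division by a density is needed.
      have hρt : ρ p.1 * |t - t'| ≤ |P - P'| + T₂ * |ρ p.1 - ρ' p.1| := by
        have e : ρ p.1 * (t - t') = (P - P') - t' * (ρ p.1 - ρ' p.1) := by
          simp only [P, P', ← hP, ← hP']; ring
        rw [← abs_of_nonneg h0, ← abs_mul, e, abs_of_nonneg h0]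
        refine (abs_sub _ _).trans ?_
        rw [abs_mul, abs_of_nonneg ht']
        gcongr
        exact hm'.2
      have hM := abs_maxwellian_sub_le hT₁ hm hm' p.2
      have hd := derivEnvelope_nonneg (T₂ := T₂) hT₁ p.2
      calc |ρ p.1 * maxwellian 0 t p.2 - ρ' p.1 * maxwellian 0 t' p.2|
          = |ρ p.1 * (maxwellian 0 t p.2 - maxwellian 0 t' p.2)
              + (ρ p.1 - ρ' p.1) * maxwellian 0 t' p.2| := by ring_nf
        _ ≤ ρ p.1 * |maxwellian 0 t p.2 - maxwellian 0 t' p.2|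
              + |ρ p.1 - ρ' p.1| * maxwellian 0 t' p.2 := by
            refine (abs_add_le _ _).trans_eq ?_
            rw [abs_mul, abs_mul, abs_of_nonneg h0, abs_of_nonneg (maxwellian_nonneg 0 t' p.2)]
        _ ≤ ρ p.1 * (derivEnvelope T₁ T₂ p.2 * |t - t'|)
              + |ρ p.1 - ρ' p.1| * maxwellian 0 t' p.2 := by gcongr
        _ = (ρ p.1 * |t - t'|) * derivEnvelope T₁ T₂ p.2
              + |ρ p.1 - ρ' p.1| * maxwellian 0 t' p.2 := by ring
        _ ≤ _ := by gcongr)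
  refine hle.trans ?_
  simp only [Pi.add_apply]
  rw [integral_add j1 j2]
  have e1 : ∫ p : UnitAddCircle × ℝ,
      (|P - P'| + T₂ * |ρ p.1 - ρ' p.1|) * derivEnvelope T₁ T₂ p.2 =
      (|P - P'| + T₂ * D) * ∫ v, derivEnvelope T₁ T₂ v := by
    refine (integral_prod_mul (fun x => |P - P'| + T₂ * |ρ x - ρ' x|) _).trans ?_
    rw [integral_add (integrable_const _) (hδ.abs.const_mul _), integral_const_mul]
    simp [D]
  have e2 : ∫ p : UnitAddCircle × ℝ, |ρ p.1 - ρ' p.1| * maxwellian 0 (temp τ ρ' p.1) p.2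
      = D := by
    refine (integral_prod _ j2).trans (integral_congr_ae ?_)
    filter_upwards [h'.temp_pos hT₁] with x hx
    simp only [integral_const_mul, integral_maxwellian hx, mul_one]
  rw [e1, e2]
  have hI : 0 ≤ ∫ v, derivEnvelope T₁ T₂ v :=
    integral_nonneg fun v => derivEnvelope_nonneg hT₁ v
  unfold lipConst
  nlinarith

/-- The function `f (·, v)` is integrable. -/
def SectionIntegrable (f : UnitAddCircle → ℝ → ℝ) (v : ℝ) : Prop := Integrable fun x => f x v

lemma ae_sectionIntegrable {f : UnitAddCircle → ℝ → ℝ}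
    (hf : Integrable fun p : UnitAddCircle × ℝ => f p.1 p.2) :
    ∀ᵐ p : UnitAddCircle × ℝ, SectionIntegrable f p.2 :=
  have h : ∀ᵐ v, SectionIntegrable f v := hf.prod_left_ae
  (Measure.quasiMeasurePreserving_snd (μ := (volume : Measure UnitAddCircle))
    (ν := (volume : Measure ℝ))).ae h

lemma abs_mild_sub_le (hα : 0 ≤ α) (hα' : α ≤ 1) {q q' A B : UnitAddCircle → ℝ → ℝ} {v : ℝ}
    (hq : SectionIntegrable q v) (hq' : SectionIntegrable q' v) (hA : SectionIntegrable A v)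
    (hB : SectionIntegrable B v) (h : ∀ x v, q x v - q' x v = α * A x v + (1 - α) * B x v)
    (x : UnitAddCircle) :
    |mild κ q x v - mild κ q' x v| ≤ α * |mild κ A x v| + (1 - α) * |mild κ B x v| := by
  rw [← mild_sub κ hq hq']
  have a1 := mild_const_mul κ (fun _ => α) A x v
  have a2 := mild_const_mul κ (fun _ => 1 - α) B x v
  have a3 := mild_add κ (q := fun x v => α * A x v) (q' := fun x v => (1 - α) * B x v) (v := v)
    (Integrable.const_mul hA _) (Integrable.const_mul hB _) x
  simp only [h]
  rw [a3, a1, a2]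
  refine (abs_add_le _ _).trans_eq ?_
  rw [abs_mul, abs_mul, abs_of_nonneg hα, abs_of_nonneg (sub_nonneg.2 hα')]

lemma integral_abs_mild_sub_le (hκ : 0 < κ) (hα : 0 ≤ α) (hα' : α ≤ 1)
    {q q' A B : UnitAddCircle → ℝ → ℝ}
    (hq : Integrable fun p : UnitAddCircle × ℝ => q p.1 p.2)
    (hq' : Integrable fun p : UnitAddCircle × ℝ => q' p.1 p.2)
    (hA : Integrable fun p : UnitAddCircle × ℝ => A p.1 p.2)
    (hB : Integrable fun p : UnitAddCircle × ℝ => B p.1 p.2)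
    (h : ∀ x v, q x v - q' x v = α * A x v + (1 - α) * B x v) :
    ∫ x, |(∫ v, mild κ q x v) - ∫ v, mild κ q' x v| ≤
      α * (∫ p : UnitAddCircle × ℝ, |mild κ A p.1 p.2|)
        + (1 - α) * ∫ p : UnitAddCircle × ℝ, |mild κ B p.1 p.2| := by
  have m := integrable_mild hκ hq
  have m' := integrable_mild hκ hq'
  have mA := integrable_mild hκ hA
  have mB := integrable_mild hκ hB
  have e1 : ∫ x, |(∫ v, mild κ q x v) - ∫ v, mild κ q' x v| =
      ∫ x, |∫ v, (mild κ q x v - mild κ q' x v)| := by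
    refine integral_congr_ae ?_
    filter_upwards [m.prod_right_ae, m'.prod_right_ae] with x hx hx'
    rw [integral_sub hx hx']
  have e2 : ∀ᵐ p : UnitAddCircle × ℝ, |mild κ q p.1 p.2 - mild κ q' p.1 p.2| ≤
        α * |mild κ A p.1 p.2| + (1 - α) * |mild κ B p.1 p.2| := by
    filter_upwards [ae_sectionIntegrable hq, ae_sectionIntegrable hq', ae_sectionIntegrable hA,
      ae_sectionIntegrable hB] with p h1 h2 h3 h4
    exact abs_mild_sub_le hα hα' h1 h2 h3 h4 h p.1
  have d : Integrable fun p : UnitAddCircle × ℝ => mild κ q p.1 p.2 - mild κ q' p.1 p.2 :=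
    m.sub m'
  have d' : Integrable fun p : UnitAddCircle × ℝ =>
    α * |mild κ A p.1 p.2| + (1 - α) * |mild κ B p.1 p.2| :=
    (mA.abs.const_mul _).add (mB.abs.const_mul _)
  have e3 := integral_abs_integral_le (F := fun x v => mild κ q x v - mild κ q' x v) d
  have e4 := integral_mono_ae d.abs d' e2
  have e5 : ∫ p : UnitAddCircle × ℝ, (α * |mild κ A p.1 p.2| + (1 - α) * |mild κ B p.1 p.2|) =
      α * (∫ p : UnitAddCircle × ℝ, |mild κ A p.1 p.2|)
        + (1 - α) * ∫ p : UnitAddCircle × ℝ, |mild κ B p.1 p.2| := by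
    rw [integral_add (mA.abs.const_mul _) (mB.abs.const_mul _), integral_const_mul,
      integral_const_mul]
  rw [e1, ← e5]
  exact e3.trans e4

/-- Contraction estimate in `L¹` for the map `ρ ↦ next κ α τ ρ`. -/
lemma integral_abs_next_sub_le (hκ : 0 < κ) (hα : 0 ≤ α) (hα' : α ≤ 1)
    (hτ : Thermostat τ₁ τ₂ τ) (h₁ : 0 < τ₁) (h₁₂ : τ₁ ≤ τ₂) (hT₁ : 0 < T₁) (hT₁₂ : T₁ ≤ T₂)
    (h : Admissible τ T₁ T₂ ρ) (h' : Admissible τ T₁ T₂ ρ') :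
    ∫ x, |next κ α τ ρ x - next κ α τ ρ' x| ≤
      (α * lipConst τ₂ T₁ T₂ + (1 - doeblin κ τ₁ τ₂)) * ∫ x, |ρ x - ρ' x| := by
  have hδ : Integrable fun x => ρ x - ρ' x := h.integrable.sub h'.integrable
  have hδ0 : ∫ x, (ρ x - ρ' x) = 0 := by
    rw [integral_sub h.integrable h'.integrable, h.integral_one, h'.integral_one, sub_self]
  have iA := (h.integrable_temp_part hT₁).sub (h'.integrable_temp_part hT₁)
  have hle := integral_abs_mild_sub_le hκ hα hα'
    (h.integrable_src (α := α) hT₁ hτ h₁) (h'.integrable_src (α := α) hT₁ hτ h₁)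
    (A := fun x v => ρ x * maxwellian 0 (temp τ ρ x) v - ρ' x * maxwellian 0 (temp τ ρ' x) v)
    (B := fun x v => (ρ x - ρ' x) * maxwellian 0 (τ x) v) iA (hτ.integrable_part h₁ hδ)
    (fun x v => by simp only [src_eq]; ring)
  have b1 := (integral_abs_mild_le (q := fun x v =>
    ρ x * maxwellian 0 (temp τ ρ x) v - ρ' x * maxwellian 0 (temp τ ρ' x) v) hκ iA).trans
    (integral_abs_temp_part_sub_le hτ h₁ hT₁ hT₁₂ h h')
  have b2 := integral_abs_mild_thermostat_le hκ hτ h₁ h₁₂ hδ hδ0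
  have b3 : 0 ≤ (1 - doeblin κ τ₁ τ₂) * ∫ x, |ρ x - ρ' x| :=
    mul_nonneg (sub_nonneg.2 (doeblin_le_one h₁ h₁₂)) (integral_nonneg fun _ => abs_nonneg _)
  refine hle.trans ?_
  nlinarith [mul_le_mul_of_nonneg_left b1 hα, mul_le_mul_of_nonneg_left b2 (sub_nonneg.2 hα'),
    mul_nonneg hα b3]

end Estimates

/-! ### Density bounds and the fixed point -/

section Bounds

variable {κ α τ₁ τ₂ T₁ T₂ a b ε : ℝ} {τ ρ : UnitAddCircle → ℝ}

/-- The local-Maxwellian part is dropped and the minorization is applied to the thermostat part,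
whose density has mass one. -/
lemma mild_src_ge (hκ : 0 < κ) (hα : 0 ≤ α) (hα' : α ≤ 1) (hτ : Thermostat τ₁ τ₂ τ) (h₁ : 0 < τ₁)
    (hρ : Integrable ρ) (hρ0 : ∀ᵐ x, 0 ≤ ρ x) (hρ1 : ∫ x, ρ x = 1) {v : ℝ} (hv : v ≠ 0)
    (hs : SectionIntegrable (src α τ ρ) v) (x : UnitAddCircle) :
    (1 - α) * minorant κ τ₁ τ₂ v ≤ mild κ (src α τ ρ) x v := by
  have e : (1 - α) * minorant κ τ₁ τ₂ v = ∫ y, (1 - α) * minorant κ τ₁ τ₂ v * ρ y := by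
    rw [integral_const_mul, hρ1, mul_one]
  rw [e, mild]
  refine integral_mono_ae (hρ.const_mul _) (integrable_kern_mul _ _ hs) (hρ0.mono fun y hy => ?_)
  have h1 := minorant_le h₁ (hτ.mem y) hκ hv (x - y)
  have h2 : 0 ≤ kern (1 / (κ * v)) (x - y) * (α * (ρ y * maxwellian 0 (temp τ ρ y) v)) :=
    mul_nonneg (kern_nonneg _ _) (mul_nonneg hα (mul_nonneg hy (maxwellian_nonneg _ _ _)))
  have h3 := mul_le_mul_of_nonneg_right h1 (mul_nonneg (sub_nonneg.2 hα') hy)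
  simp only [src_eq]
  linarith

lemma mild_le_of_le (hκ : 0 < κ) {q : UnitAddCircle → ℝ → ℝ} {v : ℝ} (hv : v ≠ 0)
    (hq : SectionIntegrable q v) {C : ℝ} (hC : ∀ᵐ y, q y v ≤ C) (x : UnitAddCircle) :
    mild κ q x v ≤ C := by
  have h := mild_mono κ (q' := fun _ _ => C) hq (integrable_const C) hC x
  refine h.trans_eq ?_
  rw [mild, integral_mul_const, integral_kern_left (one_div_mul_ne_zero hκ hv), one_mul]

lemma mild_le_integral (hκ : 0 < κ) (hε : 0 < ε) {q : UnitAddCircle → ℝ → ℝ} {v : ℝ}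
    (hv : ε ≤ |v|) (hq : SectionIntegrable q v) (h0 : ∀ᵐ y, 0 ≤ q y v) (x : UnitAddCircle) :
    mild κ q x v ≤ (1 + 1 / (κ * ε)) * ∫ y, q y v := by
  rw [mild, ← integral_const_mul]
  refine integral_mono_ae (integrable_kern_mul _ _ hq) (Integrable.const_mul hq _)
    (h0.mono fun y hy => mul_le_mul_of_nonneg_right ((kern_le _ _).trans ?_) hy)
  rw [abs_div, abs_mul, abs_one, abs_of_pos hκ]
  gcongr

lemma mild_combination (α : ℝ) {q A B : UnitAddCircle → ℝ → ℝ} {v : ℝ}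
    (hA : SectionIntegrable A v) (hB : SectionIntegrable B v)
    (h : ∀ x, q x v = α * A x v + (1 - α) * B x v) (x : UnitAddCircle) :
    mild κ q x v = α * mild κ A x v + (1 - α) * mild κ B x v := by
  have a1 := mild_const_mul κ (fun _ => α) A x v
  have a2 := mild_const_mul κ (fun _ => 1 - α) B x v
  have a3 := mild_add κ (q := fun x v => α * A x v) (q' := fun x v => (1 - α) * B x v) (v := v)
    (Integrable.const_mul hA _) (Integrable.const_mul hB _) x
  rw [← a1, ← a2, ← a3]
  exact mild_congr κ (ae_of_all _ h) x

/-- The majorant in `v` for the solution of the transport equation. -/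
noncomputable def majorant (κ α τ₁ T₁ T₂ b ε : ℝ) (τ ρ : UnitAddCircle → ℝ) (v : ℝ) : ℝ :=
  α * (b * envelope T₁ T₂ v) + ((Set.Ioo (-ε) ε).indicator
    (fun _ => b * (Real.sqrt (2 * Real.pi * τ₁))⁻¹) v
      + (1 + 1 / (κ * ε)) * ∫ y, ρ y * maxwellian 0 (τ y) v)

/-- The Maxwellian with density `ρ`, temperature `θ` and zero bulk velocity. -/
noncomputable def gain (ρ θ : UnitAddCircle → ℝ) (x : UnitAddCircle) (v : ℝ) : ℝ :=
  ρ x * maxwellian 0 (θ x) v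

/-- The local part uses the sup bound `b` at all velocities, which is affordable because of its
factor `α`. In the thermostat part, `b` is used only for `|v| < ε`; faster particles are controlled
by the kernel bound and the total mass, without `b`. -/
lemma mild_src_le (hκ : 0 < κ) (hα : 0 ≤ α) (hτ : Thermostat τ₁ τ₂ τ) (h₁ : 0 < τ₁)
    (hT₁ : 0 < T₁) (hε : 0 < ε) (h : Admissible τ T₁ T₂ ρ) (hb0 : 0 ≤ b) (hb : ∀ᵐ x, ρ x ≤ b)
    {v : ℝ} (hv : v ≠ 0)
    (hs : SectionIntegrable (gain ρ (temp τ ρ)) v)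
    (x : UnitAddCircle) :
    mild κ (src α τ ρ) x v ≤ majorant κ α τ₁ T₁ T₂ b ε τ ρ v := by
  have hs' : SectionIntegrable (gain ρ τ) v :=
    hτ.integrable_section h₁ h.integrable v
  have hnn : ∀ᵐ y, 0 ≤ gain ρ τ y v :=
    h.nonneg.mono fun y hy => mul_nonneg hy (maxwellian_nonneg _ _ _)
  have a4 := mild_combination (κ := κ) α hs hs' (fun y => src_eq α τ ρ y v) x
  have b1 : mild κ (gain ρ (temp τ ρ)) x v ≤ b * envelope T₁ T₂ v := by
    refine mild_le_of_le hκ hv hs ?_ x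
    filter_upwards [hb, h.temp_mem] with y h2 h3
    exact mul_le_mul h2 (maxwellian_le hT₁ h3.1 h3.2 v) (maxwellian_nonneg _ _ _) hb0
  have b2 : 0 ≤ mild κ (gain ρ τ) x v := mild_nonneg κ hnn x
  have b3 : mild κ (gain ρ τ) x v ≤
      (Set.Ioo (-ε) ε).indicator (fun _ => b * (Real.sqrt (2 * Real.pi * τ₁))⁻¹) v
      + (1 + 1 / (κ * ε)) * ∫ y, ρ y * maxwellian 0 (τ y) v := by
    have c1 : 0 ≤ (1 + 1 / (κ * ε)) * ∫ y, ρ y * maxwellian 0 (τ y) v :=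
      mul_nonneg (by positivity) (integral_nonneg_of_ae hnn)
    by_cases hve : |v| < ε
    · rw [Set.indicator_of_mem (Set.mem_Ioo.2 (abs_lt.1 hve))]
      have : mild κ (gain ρ τ) x v ≤
          b * (Real.sqrt (2 * Real.pi * τ₁))⁻¹ := by
        refine mild_le_of_le hκ hv hs' ?_ x
        filter_upwards [hb] with y h2
        refine mul_le_mul h2 ((maxwellian_le h₁ (hτ.mem y).1 (hτ.mem y).2 v).trans ?_)
          (maxwellian_nonneg _ _ _) hb0
        have h3 : Real.exp (-v ^ 2 / (2 * τ₂)) ≤ 1 := by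
          apply Real.exp_le_one_iff.2
          have := h₁.trans_le ((hτ.mem y).1.trans (hτ.mem y).2)
          exact div_nonpos_of_nonpos_of_nonneg (neg_nonpos.2 (sq_nonneg v)) (by positivity)
        exact mul_le_of_le_one_right (by positivity) h3
      linarith
    · rw [Set.indicator_of_notMem (fun hm => hve (abs_lt.2 (Set.mem_Ioo.1 hm))), zero_add]
      exact mild_le_integral hκ hε (not_lt.1 hve) hs' hnn x
  rw [a4, majorant]
  exact add_le_add (mul_le_mul_of_nonneg_left b1 hα)
    ((mul_le_of_le_one_left b2 (by linarith)).trans b3)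

lemma integrable_majorant_parts (hτ : Thermostat τ₁ τ₂ τ) (h₁ : 0 < τ₁) (hρ : Integrable ρ) :
    Integrable fun v => ∫ y, ρ y * maxwellian 0 (τ y) v :=
  (hτ.integrable_part h₁ hρ).integral_prod_right

lemma integrable_small (C : ℝ) :
    Integrable ((Set.Ioo (-ε) ε).indicator fun _ : ℝ => C) :=
  (integrable_indicator_iff measurableSet_Ioo).2 (integrableOn_const (by simp))

lemma integrable_majorant (hτ : Thermostat τ₁ τ₂ τ) (h₁ : 0 < τ₁) (hT₂ : 0 < T₂)
    (hρ : Integrable ρ) : Integrable (majorant κ α τ₁ T₁ T₂ b ε τ ρ) :=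
  (((integrable_envelope hT₂).const_mul _).const_mul _).add
    ((integrable_small _).add ((integrable_majorant_parts hτ h₁ hρ).const_mul _))

lemma integral_majorant (hτ : Thermostat τ₁ τ₂ τ) (h₁ : 0 < τ₁) (hT₂ : 0 < T₂) (hε : 0 < ε)
    (hρ : Integrable ρ) (hρ1 : ∫ x, ρ x = 1) :
    ∫ v, majorant κ α τ₁ T₁ T₂ b ε τ ρ v = α * (b * ∫ v, envelope T₁ T₂ v)
      + (2 * ε * (b * (Real.sqrt (2 * Real.pi * τ₁))⁻¹) + (1 + 1 / (κ * ε))) := by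
  have i1 : Integrable fun v => α * (b * envelope T₁ T₂ v) :=
    ((integrable_envelope hT₂).const_mul _).const_mul _
  have i2 := integrable_small (ε := ε) (b * (Real.sqrt (2 * Real.pi * τ₁))⁻¹)
  have i3 := (integrable_majorant_parts hτ h₁ hρ).const_mul (1 + 1 / (κ * ε))
  have e3 : ∫ v, ∫ y, ρ y * maxwellian 0 (τ y) v = 1 := by
    rw [← integral_integral_swap (f := fun y v => ρ y * maxwellian 0 (τ y) v)
      (hτ.integrable_part h₁ hρ)]
    simp only [integral_const_mul, integral_maxwellian (h₁.trans_le (hτ.mem _).1), mul_one, hρ1]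
  unfold majorant
  have i23 : Integrable fun v => (Set.Ioo (-ε) ε).indicator
      (fun _ => b * (Real.sqrt (2 * Real.pi * τ₁))⁻¹) v
      + (1 + 1 / (κ * ε)) * ∫ y, ρ y * maxwellian 0 (τ y) v := i2.add i3
  rw [integral_add i1 i23, integral_add i2 i3, integral_const_mul, integral_const_mul,
    integral_const_mul, e3, integral_indicator measurableSet_Ioo, setIntegral_const]
  simp only [Real.volume_real_Ioo_of_le (by linarith : -ε ≤ ε), smul_eq_mul]
  ring

lemma next_bounds (hκ : 0 < κ) (hα : 0 ≤ α) (hα' : α ≤ 1) (hτ : Thermostat τ₁ τ₂ τ) (h₁ : 0 < τ₁)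
    (h₁₂ : τ₁ ≤ τ₂) (hT₁ : 0 < T₁) (hT₁₂ : T₁ ≤ T₂) (hε : 0 < ε) (h : Admissible τ T₁ T₂ ρ)
    (hb0 : 0 ≤ b) (hb : ∀ᵐ x, ρ x ≤ b) :
    ∀ᵐ x, (1 - α) * doeblin κ τ₁ τ₂ ≤ next κ α τ ρ x ∧
      next κ α τ ρ x ≤ α * (b * ∫ v, envelope T₁ T₂ v)
      + (2 * ε * (b * (Real.sqrt (2 * Real.pi * τ₁))⁻¹) + (1 + 1 / (κ * ε))) := by
  have s := h.integrable_src (α := α) hT₁ hτ h₁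
  have hsec1 : ∀ᵐ v, SectionIntegrable (src α τ ρ) v := s.prod_left_ae
  have hsec2 : ∀ᵐ v, SectionIntegrable (gain ρ (temp τ ρ)) v :=
    (h.integrable_temp_part hT₁).prod_left_ae
  filter_upwards [(integrable_mild hκ s).prod_right_ae] with x hx
  constructor
  · rw [doeblin, ← integral_const_mul, next]
    refine integral_mono_ae ((integrable_minorant h₁ h₁₂).const_mul _) hx ?_
    filter_upwards [ae_velocity_ne_zero, hsec1] with v hv hs
    exact mild_src_ge hκ hα hα' hτ h₁ h.integrable h.nonneg h.integral_one hv hs x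
  · rw [← integral_majorant hτ h₁ (hT₁.trans_le hT₁₂) hε h.integrable h.integral_one, next]
    refine integral_mono_ae hx (integrable_majorant hτ h₁ (hT₁.trans_le hT₁₂) h.integrable) ?_
    filter_upwards [ae_velocity_ne_zero, hsec2] with v hv hs
    exact mild_src_le hκ hα hτ h₁ hT₁ hε h hb0 hb hv hs x

lemma integrable_next (hκ : 0 < κ) (hτ : Thermostat τ₁ τ₂ τ) (h₁ : 0 < τ₁) (hT₁ : 0 < T₁)
    (h : Admissible τ T₁ T₂ ρ) : Integrable (next κ α τ ρ) :=
  (integrable_mild hκ (h.integrable_src hT₁ hτ h₁)).integral_prod_left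

lemma integral_src_velocity (hT₁ : 0 < T₁) (hτ : Thermostat τ₁ τ₂ τ) (h₁ : 0 < τ₁)
    (h : Admissible τ T₁ T₂ ρ) : ∀ᵐ x, ∫ v, src α τ ρ x v = ρ x := by
  filter_upwards [h.temp_pos hT₁] with x hx
  have hx' := h₁.trans_le (hτ.mem x).1
  unfold src
  rw [integral_const_mul, integral_add ((integrable_maxwellian hx 0).const_mul _)
    ((integrable_maxwellian hx' 0).const_mul _), integral_const_mul, integral_const_mul,
    integral_maxwellian hx, integral_maxwellian hx']
  ring

lemma integral_next (hκ : 0 < κ) (hτ : Thermostat τ₁ τ₂ τ) (h₁ : 0 < τ₁) (hT₁ : 0 < T₁)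
    (h : Admissible τ T₁ T₂ ρ) : ∫ x, next κ α τ ρ x = 1 := by
  have s := h.integrable_src (α := α) hT₁ hτ h₁
  have e1 : ∫ p : UnitAddCircle × ℝ, mild κ (src α τ ρ) p.1 p.2 = ∫ x, next κ α τ ρ x :=
    integral_prod _ (integrable_mild hκ s)
  have e2 : ∫ p : UnitAddCircle × ℝ, src α τ ρ p.1 p.2 = ∫ x, ∫ v, src α τ ρ x v :=
    integral_prod _ s
  rw [← e1, integral_mild hκ s, e2, integral_congr_ae (integral_src_velocity hT₁ hτ h₁ h),
    h.integral_one]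

/-- The pressure is an average of `τ` against a probability density, so it lies in `[τ₁, τ₂]`. -/
lemma admissible_of_bounds (hτ : Thermostat τ₁ τ₂ τ) (h₁ : 0 < τ₁) (ha : 0 < a)
    (hρ : Integrable ρ) (hρ1 : ∫ x, ρ x = 1) (hab : ∀ᵐ x, a ≤ ρ x ∧ ρ x ≤ b) :
    Admissible τ (τ₁ / b) (τ₂ / a) ρ := by
  have h0 : ∀ᵐ x, 0 ≤ ρ x := hab.mono fun x hx => ha.le.trans hx.1
  refine ⟨hρ, h0, hρ1, ?_⟩
  have hP1 : τ₁ ≤ ∫ y, ρ y * τ y := by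
    have := integral_mono_ae (hρ.mul_const τ₁) (hτ.integrable_mul h₁ hρ)
      (h0.mono fun x hx => mul_le_mul_of_nonneg_left (hτ.mem x).1 hx)
    rwa [integral_mul_const, hρ1, one_mul] at this
  have hP2 : ∫ y, ρ y * τ y ≤ τ₂ := by
    have := integral_mono_ae (hτ.integrable_mul h₁ hρ) (hρ.mul_const τ₂)
      (h0.mono fun x hx => mul_le_mul_of_nonneg_left (hτ.mem x).2 hx)
    rwa [integral_mul_const, hρ1, one_mul] at this
  filter_upwards [hab] with x hx
  have hρx := ha.trans_le hx.1
  constructor <;> unfold temp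
  · gcongr
    exacts [h₁.le.trans hP1, hx.2]
  · gcongr
    exacts [h₁.le.trans (hP1.trans hP2), hx.1]

/-! ### Choice of the constants and the Banach fixed point -/

/-- Upper bound for the stationary density. -/
noncomputable def densityUpper (κ τ₁ : ℝ) : ℝ :=
  4 * (1 + 1 / (κ * (Real.sqrt (2 * Real.pi * τ₁) / 8)))

/-- Lower bound for the stationary density. -/
noncomputable def densityLower (κ τ₁ τ₂ : ℝ) : ℝ := doeblin κ τ₁ τ₂ / 2

/-- Lower bound for the stationary temperature. -/
noncomputable def tempLower (κ τ₁ : ℝ) : ℝ := τ₁ / densityUpper κ τ₁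

/-- Upper bound for the stationary temperature. -/
noncomputable def tempUpper (κ τ₁ τ₂ : ℝ) : ℝ := τ₂ / densityLower κ τ₁ τ₂

lemma one_le_densityUpper (hκ : 0 < κ) : 1 ≤ densityUpper κ τ₁ := by
  unfold densityUpper
  have : 0 ≤ 1 / (κ * (Real.sqrt (2 * Real.pi * τ₁) / 8)) := by positivity
  linarith

lemma densityLower_pos (h₁ : 0 < τ₁) (h : τ₁ ≤ τ₂) : 0 < densityLower κ τ₁ τ₂ :=
  half_pos (doeblin_pos h₁ h)

lemma densityLower_le_one (h₁ : 0 < τ₁) (h : τ₁ ≤ τ₂) : densityLower κ τ₁ τ₂ ≤ 1 := by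
  have := doeblin_le_one (κ := κ) h₁ h
  unfold densityLower; linarith

lemma tempLower_pos (hκ : 0 < κ) (h₁ : 0 < τ₁) : 0 < tempLower κ τ₁ :=
  div_pos h₁ (zero_lt_one.trans_le (one_le_densityUpper hκ))

lemma tempLower_le (hκ : 0 < κ) (h₁ : 0 < τ₁) : tempLower κ τ₁ ≤ τ₁ :=
  div_le_self h₁.le (one_le_densityUpper hκ)

lemma le_tempUpper (h₁ : 0 < τ₁) (h : τ₁ ≤ τ₂) : τ₂ ≤ tempUpper κ τ₁ τ₂ := by
  unfold tempUpper
  rw [le_div_iff₀ (densityLower_pos h₁ h)]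
  exact mul_le_of_le_one_right (h₁.le.trans h) (densityLower_le_one h₁ h)

/-- Smallness of the coupling `α` relative to the constants of the problem. -/
structure Small (κ τ₁ τ₂ α : ℝ) : Prop where
  nonneg : 0 ≤ α
  le_half : α ≤ 1 / 2
  lip : α * lipConst τ₂ (tempLower κ τ₁) (tempUpper κ τ₁ τ₂) ≤ doeblin κ τ₁ τ₂ / 2
  envelope : α * ∫ v, envelope (tempLower κ τ₁) (tempUpper κ τ₁ τ₂) v ≤ 1 / 2

/-- There is no circularity: the density and temperature bounds are fixed by `κ`, `τ₁`, `τ₂` before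
`α` is chosen. -/
lemma exists_small (hκ : 0 < κ) (h₁ : 0 < τ₁) (h₁₂ : τ₁ ≤ τ₂) :
    ∃ α₀ : ℝ, 0 < α₀ ∧ α₀ ≤ 1 ∧ ∀ α, 0 ≤ α → α ≤ α₀ → Small κ τ₁ τ₂ α := by
  have hc := doeblin_pos (κ := κ) h₁ h₁₂
  have hT := tempLower_pos (τ₁ := τ₁) hκ h₁
  have hL : 0 < lipConst τ₂ (tempLower κ τ₁) (tempUpper κ τ₁ τ₂) := by
    have h1 : 0 ≤ ∫ v, derivEnvelope (tempLower κ τ₁) (tempUpper κ τ₁ τ₂) v :=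
      integral_nonneg fun v => derivEnvelope_nonneg hT v
    have h2 := h₁.trans_le h₁₂
    have h3 := h2.trans_le (le_tempUpper (κ := κ) h₁ h₁₂)
    unfold lipConst
    positivity
  have hE : 0 ≤ ∫ v, BGK.envelope (tempLower κ τ₁) (tempUpper κ τ₁ τ₂) v :=
    integral_nonneg fun v => (envelope_pos hT v).le
  refine ⟨min (1 / 2) (min (doeblin κ τ₁ τ₂ / 2 / lipConst τ₂ (tempLower κ τ₁) (tempUpper κ τ₁ τ₂))
    (1 / 2 / (1 + ∫ v, BGK.envelope (tempLower κ τ₁) (tempUpper κ τ₁ τ₂) v))), ?_, ?_, ?_⟩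
  · exact lt_min (by norm_num) (lt_min (by positivity) (by positivity))
  · exact (min_le_left _ _).trans (by norm_num)
  · intro α hα hle
    rw [le_min_iff, le_min_iff, le_div_iff₀ hL,
      le_div_iff₀ (by positivity : 0 < 1 + ∫ v, BGK.envelope (tempLower κ τ₁) _ v)] at hle
    exact ⟨hα, hle.1, hle.2.1, by nlinarith [hle.2.2]⟩

lemma next_mem (hκ : 0 < κ) (h₁ : 0 < τ₁) (h₁₂ : τ₁ ≤ τ₂) (hα : Small κ τ₁ τ₂ α)
    (hτ : Thermostat τ₁ τ₂ τ) (h : Admissible τ (tempLower κ τ₁) (tempUpper κ τ₁ τ₂) ρ)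
    (hb : ∀ᵐ x, ρ x ≤ densityUpper κ τ₁) :
    ∀ᵐ x, densityLower κ τ₁ τ₂ ≤ next κ α τ ρ x ∧ next κ α τ ρ x ≤ densityUpper κ τ₁ := by
  have hα1 : α ≤ 1 := hα.le_half.trans (by norm_num)
  have hb1 := one_le_densityUpper (τ₁ := τ₁) hκ
  -- The slow-velocity cutoff is chosen so that slow thermostat particles contribute `b / 4`, with
  -- `b` the density bound. Fast ones contribute `b / 4` by the definition of `densityUpper`, and
  -- the local part at most `b / 2` by `Small.envelope`.
  have hε : 0 < Real.sqrt (2 * Real.pi * τ₁) / 8 := by positivity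
  have hT := ((tempLower_le hκ h₁).trans h₁₂).trans (le_tempUpper (κ := κ) h₁ h₁₂)
  filter_upwards [next_bounds hκ hα.nonneg hα1 hτ h₁ h₁₂ (tempLower_pos hκ h₁) hT hε h
    (zero_le_one.trans hb1) hb] with x hx
  refine ⟨le_trans ?_ hx.1, hx.2.trans ?_⟩
  · have := doeblin_pos (κ := κ) h₁ h₁₂
    unfold densityLower
    nlinarith [hα.le_half]
  · have e1 := mul_le_mul_of_nonneg_right hα.envelope (zero_le_one.trans hb1)
    have e2 : 2 * (Real.sqrt (2 * Real.pi * τ₁) / 8) *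
        (densityUpper κ τ₁ * (Real.sqrt (2 * Real.pi * τ₁))⁻¹) = densityUpper κ τ₁ / 4 := by
      have : Real.sqrt (2 * Real.pi * τ₁) ≠ 0 := by positivity
      field_simp
      norm_num
    have e3 : 1 + 1 / (κ * (Real.sqrt (2 * Real.pi * τ₁) / 8)) = densityUpper κ τ₁ / 4 := by
      unfold densityUpper; ring
    rw [e2, e3]
    linarith

/-- Existence of a density that is invariant under `next κ α τ`. -/
lemma exists_fixed_density (hκ : 0 < κ) (h₁ : 0 < τ₁) (h₁₂ : τ₁ ≤ τ₂) (hα : Small κ τ₁ τ₂ α)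
    (hτ : Thermostat τ₁ τ₂ τ) :
    ∃ ρ, Admissible τ (tempLower κ τ₁) (tempUpper κ τ₁ τ₂) ρ ∧ ∀ᵐ x, next κ α τ ρ x = ρ x := by
  have hα1 : α ≤ 1 := hα.le_half.trans (by norm_num)
  have hT₁ := tempLower_pos (τ₁ := τ₁) hκ h₁
  have hT := ((tempLower_le hκ h₁).trans h₁₂).trans (le_tempUpper (κ := κ) h₁ h₁₂)
  have ha := densityLower_pos (κ := κ) h₁ h₁₂
  set a := densityLower κ τ₁ τ₂
  set b := densityUpper κ τ₁
  -- An order interval in `L¹` cut by the mass constraint: closed, hence complete.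
  let S : Set (Lp ℝ 1 (volume : Measure UnitAddCircle)) :=
    Set.Icc (Lp.const 1 volume a) (Lp.const 1 volume b) ∩ {f | ∫ x, f x = 1}
  have hSmem : ∀ f : Lp ℝ 1 (volume : Measure UnitAddCircle),
      f ∈ S ↔ (∀ᵐ x, a ≤ f x ∧ f x ≤ b) ∧ ∫ x, f x = 1 := by
    intro f
    have hca := Lp.coeFn_const (p := 1) (μ := (volume : Measure UnitAddCircle)) a
    have hcb := Lp.coeFn_const (p := 1) (μ := (volume : Measure UnitAddCircle)) b
    simp only [S, Set.mem_inter_iff, Set.mem_Icc, Set.mem_ofPred_eq, ← Lp.coeFn_le]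
    refine and_congr_left fun _ => ?_
    rw [Filter.EventuallyLE, Filter.EventuallyLE, ← Filter.eventually_and]
    refine Filter.eventually_congr ?_
    filter_upwards [hca, hcb] with x h1 h2
    rw [h1, h2]
    rfl
  have hSclosed : IsClosed S :=
    isClosed_Icc.inter (isClosed_singleton.preimage continuous_integral)
  have hadm : ∀ f ∈ S, Admissible τ (tempLower κ τ₁) (tempUpper κ τ₁ τ₂) f := fun f hf =>
    admissible_of_bounds hτ h₁ ha (L1.integrable_coeFn f) ((hSmem f).1 hf).2 ((hSmem f).1 hf).1
  have hstep : ∀ f : S, ∃ g : S, ∀ᵐ x, g.1 x = next κ α τ f.1 x := by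
    rintro ⟨f, hf⟩
    have hi := integrable_next (α := α) hκ hτ h₁ hT₁ (hadm f hf)
    refine ⟨⟨hi.toL1 _, (hSmem _).2 ⟨?_, ?_⟩⟩, hi.coeFn_toL1⟩
    · filter_upwards [hi.coeFn_toL1, next_mem hκ h₁ h₁₂ hα hτ (hadm f hf)
        (((hSmem f).1 hf).1.mono fun x hx => hx.2)] with x h1 h2
      rwa [h1]
    · rw [integral_congr_ae hi.coeFn_toL1, integral_next hκ hτ h₁ hT₁ (hadm f hf)]
  choose F hF using hstep
  have hc := doeblin_pos (κ := κ) h₁ h₁₂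
  have hc1 := doeblin_le_one (κ := κ) h₁ h₁₂
  have hcontr : ContractingWith (1 - doeblin κ τ₁ τ₂ / 2).toNNReal F := by
    refine ⟨?_, LipschitzWith.of_dist_le_mul fun f g => ?_⟩
    · rw [← NNReal.coe_lt_coe, Real.coe_toNNReal _ (by linarith)]
      simp only [NNReal.coe_one]
      linarith
    · rw [Real.coe_toNNReal _ (by linarith), Subtype.dist_eq, Subtype.dist_eq,
        L1.dist_eq_integral_dist, L1.dist_eq_integral_dist]
      simp only [Real.dist_eq]
      have hle := integral_abs_next_sub_le hκ hα.nonneg hα1 hτ h₁ h₁₂ hT₁ hT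
        (hadm f.1 f.2) (hadm g.1 g.2)
      have hcongr : ∫ x, |(F f).1 x - (F g).1 x| =
          ∫ x, |next κ α τ f.1 x - next κ α τ g.1 x| := by
        refine integral_congr_ae ?_
        filter_upwards [hF f, hF g] with x h1 h2
        rw [h1, h2]
      rw [hcongr]
      refine hle.trans (mul_le_mul_of_nonneg_right ?_ (integral_nonneg fun _ => abs_nonneg _))
      linarith [hα.lip]
  have : Nonempty S := by
    -- The uniform density lies in the set.
    refine ⟨⟨Lp.const 1 volume 1, (hSmem _).2 ⟨?_, ?_⟩⟩⟩
    · filter_upwards [Lp.coeFn_const (p := 1) (μ := (volume : Measure UnitAddCircle)) (1 : ℝ)]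
        with x hx
      rw [hx]
      exact ⟨densityLower_le_one h₁ h₁₂, one_le_densityUpper hκ⟩
    · rw [integral_congr_ae (Lp.coeFn_const (p := 1)
        (μ := (volume : Measure UnitAddCircle)) (1 : ℝ))]
      simp
  have : CompleteSpace S := hSclosed.completeSpace_coe
  let f := ContractingWith.fixedPoint F hcontr
  refine ⟨f.1, hadm f.1 f.2, ?_⟩
  have hfix : F f = f := hcontr.fixedPoint_isFixedPt
  filter_upwards [hF f] with x hx
  rw [← hx, hfix]

end Bounds

/-! ### Test functions -/

section TestFunctions

variable {φ : UnitAddCircle × ℝ → ℝ}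

/-- Test functions are smooth on the lift to `ℝ × ℝ`; continuity of `φ` and `dx φ` descends along
this quotient map. -/
lemma isOpenQuotientMap_lift :
    IsOpenQuotientMap (Prod.map ((↑) : ℝ → UnitAddCircle) (id : ℝ → ℝ)) :=
  QuotientAddGroup.isOpenQuotientMap_mk.prodMap IsOpenQuotientMap.id

lemma IsTestFunction.continuous (hφ : IsTestFunction φ) : Continuous φ :=
  isOpenQuotientMap_lift.isQuotientMap.continuous_iff.2 hφ.smooth.continuous

lemma IsTestFunction.hasDerivAt_lift (hφ : IsTestFunction φ) (s v : ℝ) :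
    HasDerivAt (fun s : ℝ => φ ((s : UnitAddCircle), v))
      (fderiv ℝ (fun p : ℝ × ℝ => φ ((p.1 : UnitAddCircle), p.2)) (s, v) (1, 0)) s := by
  have h1 := ((hφ.smooth.differentiable (by simp)) (s, v)).hasFDerivAt
  have h2 : HasDerivAt (fun s : ℝ => (s, v)) ((1 : ℝ), (0 : ℝ)) s :=
    (hasDerivAt_id s).prodMk (hasDerivAt_const s v)
  exact h1.comp_hasDerivAt s h2

lemma IsTestFunction.dx_coe (hφ : IsTestFunction φ) (s v : ℝ) : dx φ (s : UnitAddCircle) v =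
    fderiv ℝ (fun p : ℝ × ℝ => φ ((p.1 : UnitAddCircle), p.2)) (s, v) (1, 0) := by
  unfold dx
  have h : (fun t : ℝ => φ ((s : UnitAddCircle) + (t : UnitAddCircle), v)) =
      fun t : ℝ => (fun s : ℝ => φ ((s : UnitAddCircle), v)) (s + t) := by
    funext t
    simp only [AddCircle.coe_add]
  rw [h, deriv_comp_const_add (fun s : ℝ => φ ((s : UnitAddCircle), v)) s, add_zero]
  exact (hφ.hasDerivAt_lift s v).deriv

lemma IsTestFunction.hasDerivAt (hφ : IsTestFunction φ) (s v : ℝ) :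
    HasDerivAt (fun s : ℝ => φ ((s : UnitAddCircle), v)) (dx φ (s : UnitAddCircle) v) s := by
  rw [hφ.dx_coe]; exact hφ.hasDerivAt_lift s v

lemma IsTestFunction.continuous_dx (hφ : IsTestFunction φ) :
    Continuous fun p : UnitAddCircle × ℝ => dx φ p.1 p.2 := by
  refine isOpenQuotientMap_lift.isQuotientMap.continuous_iff.2 ?_
  have h : ((fun p : UnitAddCircle × ℝ => dx φ p.1 p.2) ∘
      Prod.map ((↑) : ℝ → UnitAddCircle) (id : ℝ → ℝ)) = fun p : ℝ × ℝ =>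
        fderiv ℝ (fun p : ℝ × ℝ => φ ((p.1 : UnitAddCircle), p.2)) p (1, 0) := by
    funext p
    exact hφ.dx_coe p.1 p.2
  rw [h]
  exact (hφ.smooth.continuous_fderiv (by simp)).clm_apply continuous_const

lemma IsTestFunction.exists_bound_dx (hφ : IsTestFunction φ) :
    ∃ C, ∀ p : UnitAddCircle × ℝ, ‖dx φ p.1 p.2‖ ≤ C := by
  refine hφ.continuous_dx.bounded_above_of_compact_support
    (HasCompactSupport.intro (K := Set.univ ×ˢ (Prod.snd '' tsupport φ))
      (isCompact_univ.prod (hφ.compactSupport.isCompact.image continuous_snd)) fun p hp => ?_)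
  have h0 : ∀ x, φ (x, p.2) = 0 := fun x => by
    by_contra hne
    exact hp ⟨Set.mem_univ _, (x, p.2), subset_tsupport _ hne, rfl⟩
  simp only [dx, h0, deriv_const]

lemma IsTestFunction.exists_bound (hφ : IsTestFunction φ) : ∃ C, ∀ p, ‖φ p‖ ≤ C :=
  hφ.continuous.bounded_above_of_compact_support hφ.compactSupport

end TestFunctions

/-- The function `mild κ q` solves the transport equation in the sense of distributions. -/
lemma integral_mild_weak {κ : ℝ} (hκ : 0 < κ) {q : UnitAddCircle → ℝ → ℝ}
    (hq : Integrable fun p : UnitAddCircle × ℝ => q p.1 p.2)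
    (hq1 : Integrable fun p : UnitAddCircle × ℝ => p.2 * q p.1 p.2)
    {φ : UnitAddCircle × ℝ → ℝ} (hφ : IsTestFunction φ) :
    ∫ p : UnitAddCircle × ℝ, (p.2 * mild κ q p.1 p.2 * dx φ p.1 p.2
      + (1 / κ) * (q p.1 p.2 - mild κ q p.1 p.2) * φ p) = 0 := by
  obtain ⟨C, hC⟩ := hφ.exists_bound_dx
  obtain ⟨C', hC'⟩ := hφ.exists_bound
  have hm := integrable_mild hκ hq
  have hm1 := integrable_mul_mild hκ (r := fun v => v) hq1
  have i1 : Integrable fun p : UnitAddCircle × ℝ => p.2 * mild κ q p.1 p.2 * dx φ p.1 p.2 :=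
    hm1.mul_bdd hφ.continuous_dx.aestronglyMeasurable (ae_of_all _ hC)
  have i2 : Integrable fun p : UnitAddCircle × ℝ =>
      (1 / κ) * (q p.1 p.2 - mild κ q p.1 p.2) * φ p :=
    ((hq.sub hm).const_mul _).mul_bdd hφ.continuous.aestronglyMeasurable (ae_of_all _ hC')
  refine (integral_prod_symm _ (i1.add i2)).trans (integral_eq_zero_of_ae ?_)
  have s1 : ∀ᵐ v, SectionIntegrable q v := hq.prod_left_ae
  have s2 : ∀ᵐ v, SectionIntegrable (mild κ q) v := hm.prod_left_ae
  filter_upwards [ae_velocity_ne_zero, s1, s2] with v hv h1 h2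
  have c1 : Continuous fun x => φ (x, v) := hφ.continuous.comp (by fun_prop)
  have c2 : Continuous fun x => dx φ x v := hφ.continuous_dx.comp (f := fun x => (x, v))
    (by fun_prop)
  have c3 : Continuous fun x => κ * v * dx φ x v - φ (x, v) := (continuous_const.mul c2).sub c1
  have key := integral_mild_smul_sub (E := ℝ) hκ hv h1 (ψ := fun x => φ (x, v))
    (ψ' := fun x => dx φ x v) (fun s => hφ.hasDerivAt s v) c1 c2
  simp only [smul_eq_mul] at key
  have j1 : Integrable fun x => mild κ q x v * (κ * v * dx φ x v - φ (x, v)) := by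
    obtain ⟨D, hD⟩ := isCompact_univ.exists_bound_of_continuousOn
      (f := fun x => κ * v * dx φ x v - φ (x, v)) c3.continuousOn
    exact Integrable.mul_bdd h2 c3.aestronglyMeasurable (ae_of_all _ fun x => hD x (Set.mem_univ x))
  have j2 : Integrable fun x => q x v * φ (x, v) :=
    Integrable.mul_bdd h1 c1.aestronglyMeasurable (ae_of_all _ fun x => hC' (x, v))
  have e : ∀ x, v * mild κ q x v * dx φ x v + (1 / κ) * (q x v - mild κ q x v) * φ (x, v) =
      (1 / κ) * (mild κ q x v * (κ * v * dx φ x v - φ (x, v)) + q x v * φ (x, v)) := fun x => by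
    have := hκ.ne'
    field_simp
    ring
  change ∫ x, (v * mild κ q x v * dx φ x v + (1 / κ) * (q x v - mild κ q x v) * φ (x, v)) = 0
  simp only [e]
  rw [integral_const_mul, integral_add j1 j2, key, neg_add_cancel, mul_zero]

/-! ### From an invariant density to a steady state -/

section Existence

variable {κ α τ₁ τ₂ T₁ T₂ : ℝ} {τ ρ : UnitAddCircle → ℝ}

lemma integral_id_src (hT₁ : 0 < T₁) (hτ : Thermostat τ₁ τ₂ τ) (h₁ : 0 < τ₁)
    (h : Admissible τ T₁ T₂ ρ) : ∀ᵐ x, ∫ v, v * src α τ ρ x v = 0 := by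
  filter_upwards [h.temp_pos hT₁] with x hx
  have hx' := h₁.trans_le (hτ.mem x).1
  have e : ∀ v, v * src α τ ρ x v = ρ x * (α * (v * maxwellian 0 (temp τ ρ x) v)
      + (1 - α) * (v * maxwellian 0 (τ x) v)) := fun v => by unfold src; ring
  simp only [e]
  rw [integral_const_mul, integral_add ((integrable_id_mul_maxwellian hx 0).const_mul _)
    ((integrable_id_mul_maxwellian hx' 0).const_mul _), integral_const_mul, integral_const_mul,
    integral_id_mul_maxwellian hx, integral_id_mul_maxwellian hx']
  ring

lemma integral_sq_src (hT₁ : 0 < T₁) (hτ : Thermostat τ₁ τ₂ τ) (h₁ : 0 < τ₁)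
    (h : Admissible τ T₁ T₂ ρ) :
    ∫ x, ∫ v, v ^ 2 * src α τ ρ x v = ∫ y, ρ y * τ y := by
  have hx : ∀ᵐ x, ∫ v, v ^ 2 * src α τ ρ x v =
      α * (∫ y, ρ y * τ y) + (1 - α) * (ρ x * τ x) := by
    filter_upwards [h.temp_pos hT₁, h.mul_temp hT₁] with x hx hP
    have hx' := h₁.trans_le (hτ.mem x).1
    have e : ∀ v, v ^ 2 * src α τ ρ x v = ρ x * (α * (v ^ 2 * maxwellian 0 (temp τ ρ x) v)
        + (1 - α) * (v ^ 2 * maxwellian 0 (τ x) v)) := fun v => by unfold src; ring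
    simp only [e]
    rw [integral_const_mul, integral_add ((integrable_sq_mul_maxwellian hx 0).const_mul _)
      ((integrable_sq_mul_maxwellian hx' 0).const_mul _), integral_const_mul, integral_const_mul,
      integral_sq_mul_maxwellian hx, integral_sq_mul_maxwellian hx', ← hP]
    ring
  rw [integral_congr_ae hx, integral_add (integrable_const _)
    ((hτ.integrable_mul h₁ h.integrable).const_mul _), integral_const, probReal_univ,
    one_smul, integral_const_mul]
  ring

/-- The conditions on the moments of `g` at `x` that characterize good points. -/
def MomentsAt (τ ρ : UnitAddCircle → ℝ) (T₁ T₂ : ℝ) (g : UnitAddCircle → ℝ → ℝ)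
    (x : UnitAddCircle) : Prop :=
  density g x = ρ x ∧ ∫ v, v * g x v = 0 ∧ pressure g x = ∫ y, ρ y * τ y ∧
    temp τ ρ x ∈ Set.Icc T₁ T₂

lemma MomentsAt.collision_eq {g : UnitAddCircle → ℝ → ℝ} {x : UnitAddCircle}
    (h : MomentsAt τ ρ T₁ T₂ g x) (v : ℝ) :
    collision κ α τ g x v = (1 / κ) * (src α τ ρ x v - g x v) := by
  obtain ⟨h1, h2, h3, _⟩ := h
  have hu : bulkVelocity g x = 0 := by rw [bulkVelocity, h2, zero_div]
  have hθ : localTemperature g x = temp τ ρ x := by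
    rw [localTemperature, hu, h1, h3, temp]; ring
  rw [collision, hu, hθ, h1, src]

lemma MomentsAt.temperatureProfile_eq {g : UnitAddCircle → ℝ → ℝ} {x : UnitAddCircle}
    (h : MomentsAt τ ρ T₁ T₂ g x) : temperatureProfile g x = temp τ ρ x := by
  rw [temperatureProfile, h.1, h.2.2.1, temp]

/-- The fixed-point property is the mass balance, and the source carries no momentum, so
`ModeEq.flux_pressure` applies with `β = 0`. The moments of the solution are therefore those assumed
in its source. -/
lemma ae_momentsAt (hκ : 0 < κ) (h₁ : 0 < τ₁) (hT₁ : 0 < T₁) (hτ : Thermostat τ₁ τ₂ τ)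
    (h : Admissible τ T₁ T₂ ρ) (hfix : ∀ᵐ x, next κ α τ ρ x = ρ x) :
    ∀ᵐ x, MomentsAt τ ρ T₁ T₂ (mild κ (src α τ ρ)) x := by
  have s := h.integrable_src (α := α) hT₁ hτ h₁
  have s2 := h.integrable_sq_src (α := α) hT₁ hτ h₁
  have hmass : ∀ᵐ x, ∫ v, src α τ ρ x v = ∫ v, mild κ (src α τ ρ) x v := by
    filter_upwards [integral_src_velocity (α := α) hT₁ hτ h₁ h, hfix] with x hx hx'
    rw [hx, ← hx', next]
  have hmom : ∀ᵐ x, ∫ v, v * src α τ ρ x v = 0 * ∫ v, v * mild κ (src α τ ρ) x v := by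
    simpa only [zero_mul] using integral_id_src hT₁ hτ h₁ h
  obtain ⟨hj, hP⟩ := (modeEq_mild hκ s).flux_pressure hκ (integrable_mild hκ s)
    (integrable_mul_mild hκ (r := fun v => v ^ 2) s2) s s2 hmass zero_ne_one hmom
  rw [integral_sq_src hT₁ hτ h₁ h] at hP
  filter_upwards [hfix, hj, hP, h.temp_mem] with x a b c d
  exact ⟨a, b, c, d⟩

/-- A density that is invariant under `next κ α τ` yields a steady state. -/
lemma exists_steadyState (hκ : 0 < κ) (hα : 0 ≤ α) (hα' : α ≤ 1) (h₁ : 0 < τ₁)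
    (hT₁ : 0 < T₁) (hle : T₁ ≤ τ₁) (hle' : τ₁ ≤ T₂) (hτ : Thermostat τ₁ τ₂ τ)
    (h : Admissible τ T₁ T₂ ρ) (hfix : ∀ᵐ x, next κ α τ ρ x = ρ x) :
    ∃ g : UnitAddCircle → ℝ → ℝ, IsSteadyState κ α τ g ∧
      (∀ x, T₁ ≤ temperatureProfile g x ∧ temperatureProfile g x ≤ T₂) ∧
      ∀ᵐ p : UnitAddCircle × ℝ, g p.1 p.2 = mild κ (src α τ ρ) p.1 p.2 := by
  classical
  have s := h.integrable_src (α := α) hT₁ hτ h₁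
  have s1 := integrable_id_mul_of_sq s (h.integrable_sq_src (α := α) hT₁ hτ h₁)
  have hgood := ae_momentsAt (α := α) hκ h₁ hT₁ hτ h hfix
  let g₀ := mild κ (src α τ ρ)
  -- The temperature bounds are required at every `x`. On the null set of exceptional points the
  -- solution is replaced by a Maxwellian of admissible temperature `τ₁`.
  let g : UnitAddCircle → ℝ → ℝ := fun x =>
    if MomentsAt τ ρ T₁ T₂ g₀ x then g₀ x else maxwellian 0 τ₁
  have hg : ∀ x, MomentsAt τ ρ T₁ T₂ g₀ x → g x = g₀ x := fun x hx => if_pos hx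
  have hg' : ∀ x, ¬ MomentsAt τ ρ T₁ T₂ g₀ x → g x = maxwellian 0 τ₁ := fun x hx => if_neg hx
  have hgoodp : ∀ᵐ p : UnitAddCircle × ℝ, MomentsAt τ ρ T₁ T₂ g₀ p.1 :=
    (Measure.quasiMeasurePreserving_fst (μ := (volume : Measure UnitAddCircle))
      (ν := (volume : Measure ℝ))).ae hgood
  have heq : ∀ᵐ p : UnitAddCircle × ℝ, g p.1 p.2 = g₀ p.1 p.2 := by
    filter_upwards [hgoodp] with p hp
    rw [hg _ hp]
  have hgM : ∀ x, MomentsAt τ ρ T₁ T₂ g₀ x → MomentsAt τ ρ T₁ T₂ g x := fun x hx => by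
    unfold MomentsAt density pressure at *
    rwa [hg x hx]
  have hint : Integrable fun p : UnitAddCircle × ℝ => g₀ p.1 p.2 := integrable_mild hκ s
  refine ⟨g, ⟨?_, ?_, ?_, ?_, ?_⟩, fun x => ?_, heq⟩
  · have hnn : ∀ᵐ y, ∀ v, 0 ≤ src α τ ρ y v := h.nonneg.mono fun y hy => src_nonneg hα hα' hy
    filter_upwards [heq] with p hp
    rw [hp]
    exact mild_nonneg κ (hnn.mono fun y hy => hy p.2) p.1
  · exact hint.congr (heq.mono fun p hp => hp.symm)
  · rw [integral_congr_ae heq, integral_mild hκ s]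
    have e2 : ∫ p : UnitAddCircle × ℝ, src α τ ρ p.1 p.2 = ∫ x, ∫ v, src α τ ρ x v :=
      integral_prod _ s
    rw [e2, integral_congr_ae (integral_src_velocity hT₁ hτ h₁ h), h.integral_one]
  · refine (integrable_mul_mild hκ (r := fun v => v ^ 2)
      (h.integrable_sq_src (α := α) hT₁ hτ h₁)).congr (heq.mono fun p hp => ?_)
    simp only [hp, g₀]
  · intro φ hφ
    rw [← integral_mild_weak hκ s s1 hφ]
    refine integral_congr_ae ?_
    filter_upwards [hgoodp] with p hp
    simp only [(hgM _ hp).collision_eq, hg _ hp, g₀]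
  · by_cases hx : MomentsAt τ ρ T₁ T₂ g₀ x
    · rw [(hgM x hx).temperatureProfile_eq]
      exact hx.2.2.2
    · have e : temperatureProfile g x = τ₁ := by
        rw [temperatureProfile, pressure, density, hg' x hx, integral_sq_mul_maxwellian h₁,
          integral_maxwellian h₁]
        ring
      rw [e]
      exact ⟨hle, hle'⟩

end Existence

/-! ### Moments of steady states -/

/-- Strict positivity of the variance of a nonzero density. -/
lemma variance_pos_of_density {f : ℝ → ℝ} (h0 : ∀ᵐ v, 0 ≤ f v) (hf : Integrable f)
    (hf1 : Integrable fun v => v * f v) (hf2 : Integrable fun v => v ^ 2 * f v)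
    (hρ : 0 < ∫ v, f v) :
    0 < (∫ v, v ^ 2 * f v) / (∫ v, f v) - ((∫ v, v * f v) / ∫ v, f v) ^ 2 := by
  set ρ := ∫ v, f v
  set u := (∫ v, v * f v) / ρ
  have e : ∀ v, (v - u) ^ 2 * f v = v ^ 2 * f v - (2 * u) * (v * f v) + u ^ 2 * f v :=
    fun v => by ring
  have hi : Integrable fun v => (v - u) ^ 2 * f v := by
    simp only [e]
    exact (hf2.sub (hf1.const_mul _)).add (hf.const_mul _)
  have hval : ∫ v, (v - u) ^ 2 * f v = ρ * ((∫ v, v ^ 2 * f v) / ρ - u ^ 2) := by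
    simp only [e]
    have hu : ∫ v, v * f v = u * ρ := by simp only [u]; field_simp
    have hd : Integrable fun v => v ^ 2 * f v - (2 * u) * (v * f v) := hf2.sub (hf1.const_mul _)
    rw [integral_add hd (hf.const_mul _), integral_sub hf2 (hf1.const_mul _), integral_const_mul,
      integral_const_mul, hu]
    field_simp
    ring
  have hnn : ∀ᵐ v, 0 ≤ (v - u) ^ 2 * f v := h0.mono fun v hv => mul_nonneg (sq_nonneg _) hv
  have hpos : 0 < ∫ v, (v - u) ^ 2 * f v := by
    -- Zero variance would concentrate `f` at the single velocity `u`, a null set, against positive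
    -- mass.
    refine lt_of_le_of_ne (integral_nonneg_of_ae hnn) fun hzero => ?_
    have h1 := (integral_eq_zero_iff_of_nonneg_ae hnn hi).1 hzero.symm
    have hne : ∀ᵐ v : ℝ, v ≠ u := by simp [ae_iff]
    have h2 : ∀ᵐ v, f v = 0 := by
      filter_upwards [h1, hne] with v hv hvu
      exact (mul_eq_zero.1 hv).resolve_left (pow_ne_zero 2 (sub_ne_zero.2 hvu))
    exact hρ.ne' (integral_eq_zero_of_ae h2)
  rw [hval] at hpos
  exact pos_of_mul_pos_right hpos hρ.le

/-! ### From the weak formulation to Fourier modes -/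

lemma isTestFunction_mul {ψ : UnitAddCircle → ℝ} {χ : ℝ → ℝ}
    (hψ : ContDiff ℝ ∞ fun s : ℝ => ψ s) (hχ : ContDiff ℝ ∞ χ) (hχc : HasCompactSupport χ) :
    IsTestFunction fun p : UnitAddCircle × ℝ => ψ p.1 * χ p.2 where
  smooth := (hψ.comp contDiff_fst).mul (hχ.comp contDiff_snd)
  compactSupport := by
    refine HasCompactSupport.intro (K := Set.univ ×ˢ tsupport χ)
      (isCompact_univ.prod hχc.isCompact) fun p hp => ?_
    have : χ p.2 = 0 := by
      by_contra hne
      exact hp ⟨Set.mem_univ _, subset_tsupport _ hne⟩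
    rw [this, mul_zero]

lemma dx_mul {ψ ψ' : UnitAddCircle → ℝ} (hψ : ∀ s : ℝ, HasDerivAt (fun s : ℝ => ψ s) (ψ' s) s)
    (χ : ℝ → ℝ) (x : UnitAddCircle) (v : ℝ) :
    dx (fun p : UnitAddCircle × ℝ => ψ p.1 * χ p.2) x v = ψ' x * χ v := by
  obtain ⟨t, rfl⟩ := QuotientAddGroup.mk_surjective x
  have h := HasDerivAt.comp_const_add t 0 (hψ (t + 0))
  simp only [AddCircle.coe_add, add_zero] at h
  exact (h.mul_const (χ v)).deriv

/-- The distributional transport equation, tested in the space variable only. -/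
lemma ae_integral_section_eq_zero {κ : ℝ} {g q : UnitAddCircle → ℝ → ℝ}
    (hg : Integrable fun p : UnitAddCircle × ℝ => g p.1 p.2)
    (hg1 : Integrable fun p : UnitAddCircle × ℝ => p.2 * g p.1 p.2)
    (hq : Integrable fun p : UnitAddCircle × ℝ => q p.1 p.2)
    (hw : ∀ φ : UnitAddCircle × ℝ → ℝ, IsTestFunction φ → ∫ p : UnitAddCircle × ℝ,
      (p.2 * g p.1 p.2 * dx φ p.1 p.2 + (1 / κ) * (q p.1 p.2 - g p.1 p.2) * φ p) = 0)
    {ψ ψ' : UnitAddCircle → ℝ} (hψ : ContDiff ℝ ∞ fun s : ℝ => ψ s)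
    (hψd : ∀ s : ℝ, HasDerivAt (fun s : ℝ => ψ s) (ψ' s) s) (hψc : Continuous ψ)
    (hψ'c : Continuous ψ') :
    ∀ᵐ v : ℝ, (v * ∫ x, g x v * ψ' x) + (1 / κ) * ((∫ x, q x v * ψ x) - ∫ x, g x v * ψ x) = 0 := by
  obtain ⟨C, hC⟩ := isCompact_univ.exists_bound_of_continuousOn hψc.continuousOn
  obtain ⟨C', hC'⟩ := isCompact_univ.exists_bound_of_continuousOn hψ'c.continuousOn
  have i1 : Integrable fun p : UnitAddCircle × ℝ => p.2 * g p.1 p.2 * ψ' p.1 :=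
    hg1.mul_bdd (hψ'c.comp continuous_fst).aestronglyMeasurable
      (ae_of_all _ fun p => hC' p.1 (Set.mem_univ _))
  have i2 : Integrable fun p : UnitAddCircle × ℝ => (1 / κ) * (q p.1 p.2 - g p.1 p.2) * ψ p.1 :=
    ((hq.sub hg).const_mul _).mul_bdd (hψc.comp continuous_fst).aestronglyMeasurable
      (ae_of_all _ fun p => hC p.1 (Set.mem_univ _))
  let F : UnitAddCircle → ℝ → ℝ := fun x v =>
    v * g x v * ψ' x + (1 / κ) * (q x v - g x v) * ψ x
  have iF : Integrable fun p : UnitAddCircle × ℝ => F p.1 p.2 := i1.add i2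
  have hzero : ∀ᵐ v, ∫ x, F x v = 0 := by
    -- Product test functions `ψ(x) χ(v)` with `χ` arbitrary; the fundamental lemma of the calculus
    -- of variations in `v` leaves an identity at almost every velocity.
    refine ae_eq_zero_of_integral_contDiff_smul_eq_zero
      (iF.integral_prod_right).locallyIntegrable fun χ hχ hχc => ?_
    obtain ⟨D, hD⟩ := hχ.continuous.bounded_above_of_compact_support hχc
    have h := hw _ (isTestFunction_mul hψ hχ hχc)
    have iχ : Integrable fun p : UnitAddCircle × ℝ => F p.1 p.2 * χ p.2 :=
      iF.mul_bdd (hχ.continuous.comp continuous_snd).aestronglyMeasurable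
        (ae_of_all _ fun p => hD p.2)
    have e : ∫ p : UnitAddCircle × ℝ, F p.1 p.2 * χ p.2 = ∫ v, ∫ x, F x v * χ v :=
      integral_prod_symm _ iχ
    have e2 : ∀ v, χ v • ∫ x, F x v = ∫ x, F x v * χ v := fun v => by
      rw [integral_mul_const, smul_eq_mul, mul_comm]
    simp only [e2]
    rw [← e, ← h]
    congr 1 with p
    rw [dx_mul hψd]
    simp only [F]
    ring
  have s1 : ∀ᵐ v, SectionIntegrable g v := hg.prod_left_ae
  have s2 : ∀ᵐ v, SectionIntegrable q v := hq.prod_left_ae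
  filter_upwards [hzero, s1, s2] with v h0 h1 h2
  have j1 : Integrable fun x => g x v * ψ' x :=
    Integrable.mul_bdd h1 hψ'c.aestronglyMeasurable
      (ae_of_all _ fun x => hC' x (Set.mem_univ _))
  have j2 : Integrable fun x => g x v * ψ x :=
    Integrable.mul_bdd h1 hψc.aestronglyMeasurable (ae_of_all _ fun x => hC x (Set.mem_univ _))
  have j3 : Integrable fun x => q x v * ψ x :=
    Integrable.mul_bdd h2 hψc.aestronglyMeasurable (ae_of_all _ fun x => hC x (Set.mem_univ _))
  have e : ∀ x, F x v = v * (g x v * ψ' x) + (1 / κ) * (q x v * ψ x - g x v * ψ x) := fun x => by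
    simp only [F]; ring
  simp only [e] at h0
  have j32 : Integrable fun x => q x v * ψ x - g x v * ψ x := j3.sub j2
  rwa [integral_add (j1.const_mul _) (j32.const_mul _), integral_const_mul,
    integral_const_mul, integral_sub j3 j2] at h0

lemma contDiff_mode (n : ℤ) : ContDiff ℝ ∞ fun s : ℝ => mode n (s : UnitAddCircle) := by
  simp only [fourier_coe_apply]
  have : ContDiff ℝ ∞ fun s : ℝ => (s : ℂ) := Complex.ofRealCLM.contDiff
  fun_prop

lemma integral_smul_mode_eq {f : UnitAddCircle → ℝ} (hf : Integrable f) (n : ℤ) :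
    ∫ x, f x • mode n x =
      (∫ x, f x * (mode n x).re : ℝ) + (∫ x, f x * (mode n x).im : ℝ) * Complex.I := by
  have h := integral_re_add_im (integrable_smul_mode hf n)
  rw [← h]
  simp

/-- Weak solutions satisfy the transport equation in Fourier variables. -/
lemma modeEq_of_weak {κ : ℝ} (hκ : 0 < κ) {g q : UnitAddCircle → ℝ → ℝ}
    (hg : Integrable fun p : UnitAddCircle × ℝ => g p.1 p.2)
    (hg1 : Integrable fun p : UnitAddCircle × ℝ => p.2 * g p.1 p.2)
    (hq : Integrable fun p : UnitAddCircle × ℝ => q p.1 p.2)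
    (hw : ∀ φ : UnitAddCircle × ℝ → ℝ, IsTestFunction φ → ∫ p : UnitAddCircle × ℝ,
      (p.2 * g p.1 p.2 * dx φ p.1 p.2 + (1 / κ) * (q p.1 p.2 - g p.1 p.2) * φ p) = 0) :
    ModeEq κ g q := by
  intro n
  have hd := hasDerivAt_mode n
  have cre : Continuous fun x : UnitAddCircle => (mode n x).re :=
    Complex.continuous_re.comp (mode n).continuous
  have cim : Continuous fun x : UnitAddCircle => (mode n x).im :=
    Complex.continuous_im.comp (mode n).continuous
  have dre : ∀ s : ℝ, HasDerivAt (fun s : ℝ => (mode n (s : UnitAddCircle)).re)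
      (-(2 * Real.pi * n) * (mode n (s : UnitAddCircle)).im) s := fun s => by
    have h := Complex.reCLM.hasFDerivAt.comp_hasDerivAt s (hd s)
    refine h.congr_deriv ?_
    simp [Complex.mul_re, Complex.mul_im]
  have dim : ∀ s : ℝ, HasDerivAt (fun s : ℝ => (mode n (s : UnitAddCircle)).im)
      (2 * Real.pi * n * (mode n (s : UnitAddCircle)).re) s := fun s => by
    have h := Complex.imCLM.hasFDerivAt.comp_hasDerivAt s (hd s)
    refine h.congr_deriv ?_
    simp [Complex.mul_re, Complex.mul_im]
  -- Test functions are real, so the real and imaginary parts of a mode are tested separately.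
  -- Differentiation couples them.
  have hre := ae_integral_section_eq_zero hg hg1 hq hw
    (ψ := fun x => (mode n x).re) (ψ' := fun x => -(2 * Real.pi * n) * (mode n x).im)
    (Complex.reCLM.contDiff.comp (contDiff_mode n)) dre cre (continuous_const.mul cim)
  have him := ae_integral_section_eq_zero hg hg1 hq hw
    (ψ := fun x => (mode n x).im) (ψ' := fun x => 2 * Real.pi * n * (mode n x).re)
    (Complex.imCLM.contDiff.comp (contDiff_mode n)) dim cim (continuous_const.mul cre)
  have s1 : ∀ᵐ v, SectionIntegrable g v := hg.prod_left_ae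
  have s2 : ∀ᵐ v, SectionIntegrable q v := hq.prod_left_ae
  filter_upwards [hre, him, s1, s2] with v h1 h2 hg hq
  rw [integral_smul_mode_eq hg, integral_smul_mode_eq hq]
  have e1 : ∫ x, g x v * (-(2 * Real.pi * n) * (mode n x).im) =
      -(2 * Real.pi * n) * ∫ x, g x v * (mode n x).im := by
    rw [← integral_const_mul]; congr 1 with x; ring
  have e2 : ∫ x, g x v * (2 * Real.pi * n * (mode n x).re) =
      2 * Real.pi * n * ∫ x, g x v * (mode n x).re := by
    rw [← integral_const_mul]; congr 1 with x; ring
  rw [e1] at h1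
  rw [e2] at h2
  generalize ∫ x, g x v * (mode n x).re = a at *
  generalize ∫ x, g x v * (mode n x).im = b at *
  generalize ∫ x, q x v * (mode n x).re = c at *
  generalize ∫ x, q x v * (mode n x).im = d at *
  have hκ0 := hκ.ne'
  have f1 : c = a + κ * v * (2 * Real.pi * n) * b := by
    field_simp at h1
    linarith
  have f2 : d = b - κ * v * (2 * Real.pi * n) * a := by
    field_simp at h2
    linarith
  rw [f1, f2]
  apply Complex.ext <;> simp
  ring

/-! ### Identification and uniqueness of steady states -/

section Uniqueness

variable {κ α τ₁ τ₂ T₁ T₂ : ℝ} {τ ρ ρ' : UnitAddCircle → ℝ}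

/-- The gain term of the collision operator. -/
noncomputable def collisionGain (α : ℝ) (τ : UnitAddCircle → ℝ) (g : UnitAddCircle → ℝ → ℝ)
    (x : UnitAddCircle) (v : ℝ) : ℝ :=
  density g x * (α * maxwellian (bulkVelocity g x) (localTemperature g x) v
    + (1 - α) * maxwellian 0 (τ x) v)

/-- Nondegeneracy of the moments of a density at a point. -/
structure RegularAt (g : UnitAddCircle → ℝ → ℝ) (x : UnitAddCircle) : Prop where
  density_pos : 0 < density g x
  temp_pos : 0 < localTemperature g x

lemma RegularAt.flux {g : UnitAddCircle → ℝ → ℝ} {x : UnitAddCircle} (h : RegularAt g x) :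
    density g x * bulkVelocity g x = ∫ v, v * g x v := by
  have := h.density_pos.ne'
  unfold bulkVelocity; field_simp

lemma RegularAt.pressure {g : UnitAddCircle → ℝ → ℝ} {x : UnitAddCircle} (h : RegularAt g x) :
    density g x * (localTemperature g x + bulkVelocity g x ^ 2) = pressure g x := by
  have := h.density_pos.ne'
  unfold localTemperature; field_simp; ring

/-- Where the density vanishes, the temperature profile is zero by the convention for division,
against `T₁ > 0`. So there is no vacuum, and a nonzero density in `v` has positive variance. -/
lemma IsSteadyState.ae_regularAt {g : UnitAddCircle → ℝ → ℝ} (hg : IsSteadyState κ α τ g)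
    (hT₁ : 0 < T₁) (hT : ∀ᵐ x, T₁ ≤ temperatureProfile g x ∧ temperatureProfile g x ≤ T₂) :
    ∀ᵐ x, RegularAt g x := by
  have hg1 := integrable_id_mul_of_sq hg.integrable hg.finite_energy
  have hnn : ∀ᵐ x, ∀ᵐ v, 0 ≤ g x v := Measure.ae_ae_of_ae_prod hg.nonneg
  filter_upwards [hT, hnn, hg.integrable.prod_right_ae, hg1.prod_right_ae,
    hg.finite_energy.prod_right_ae] with x hx h0 i0 i1 i2
  have hρ : 0 < ∫ v, g x v := by
    refine lt_of_le_of_ne (integral_nonneg_of_ae h0) fun h => ?_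
    have h' : density g x = 0 := h.symm
    have := hT₁.trans_le hx.1
    rw [temperatureProfile, h', div_zero] at this
    exact lt_irrefl _ this
  exact ⟨hρ, variance_pos_of_density h0 i0 i1 i2 hρ⟩

lemma RegularAt.integral_collisionGain {g : UnitAddCircle → ℝ → ℝ} {x : UnitAddCircle}
    (h : RegularAt g x) (hτ : 0 < τ x) :
    ∫ v, collisionGain α τ g x v = density g x := by
  unfold collisionGain
  rw [integral_const_mul, integral_add ((integrable_maxwellian h.temp_pos _).const_mul _)
    ((integrable_maxwellian hτ 0).const_mul _), integral_const_mul, integral_const_mul,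
    integral_maxwellian h.temp_pos, integral_maxwellian hτ]
  ring

lemma RegularAt.integral_id_collisionGain {g : UnitAddCircle → ℝ → ℝ} {x : UnitAddCircle}
    (h : RegularAt g x) (hτ : 0 < τ x) :
    ∫ v, v * collisionGain α τ g x v = α * ∫ v, v * g x v := by
  have e : ∀ v, v * collisionGain α τ g x v =
      density g x * (α * (v * maxwellian (bulkVelocity g x) (localTemperature g x) v)
      + (1 - α) * (v * maxwellian 0 (τ x) v)) := fun v => by unfold collisionGain; ring
  simp only [e]
  rw [integral_const_mul, integral_add ((integrable_id_mul_maxwellian h.temp_pos _).const_mul _)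
    ((integrable_id_mul_maxwellian hτ 0).const_mul _), integral_const_mul, integral_const_mul,
    integral_id_mul_maxwellian h.temp_pos, integral_id_mul_maxwellian hτ, ← h.flux]
  ring

lemma RegularAt.integral_sq_collisionGain {g : UnitAddCircle → ℝ → ℝ} {x : UnitAddCircle}
    (h : RegularAt g x) (hτ : 0 < τ x) :
    ∫ v, v ^ 2 * collisionGain α τ g x v =
      α * BGK.pressure g x + (1 - α) * (density g x * τ x) := by
  have e : ∀ v, v ^ 2 * collisionGain α τ g x v =
      density g x * (α * (v ^ 2 * maxwellian (bulkVelocity g x) (localTemperature g x) v)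
      + (1 - α) * (v ^ 2 * maxwellian 0 (τ x) v)) := fun v => by unfold collisionGain; ring
  simp only [e]
  rw [integral_const_mul, integral_add ((integrable_sq_mul_maxwellian h.temp_pos _).const_mul _)
    ((integrable_sq_mul_maxwellian hτ 0).const_mul _), integral_const_mul, integral_const_mul,
    integral_sq_mul_maxwellian h.temp_pos, integral_sq_mul_maxwellian hτ, ← h.pressure]
  ring

lemma IsSteadyState.integrable_density {g : UnitAddCircle → ℝ → ℝ}
    (hg : IsSteadyState κ α τ g) : Integrable (density g) :=
  hg.integrable.integral_prod_left

lemma IsSteadyState.integrable_pressure {g : UnitAddCircle → ℝ → ℝ}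
    (hg : IsSteadyState κ α τ g) : Integrable (pressure g) :=
  hg.finite_energy.integral_prod_left

lemma IsSteadyState.integrable_collisionGain {g : UnitAddCircle → ℝ → ℝ}
    (hg : IsSteadyState κ α τ g) (hreg : ∀ᵐ x, RegularAt g x) (hτ : Thermostat τ₁ τ₂ τ)
    (h₁ : 0 < τ₁) :
    Integrable (fun p : UnitAddCircle × ℝ => collisionGain α τ g p.1 p.2) ∧
    Integrable (fun p : UnitAddCircle × ℝ => p.2 ^ 2 * collisionGain α τ g p.1 p.2) := by
  have hg1 := integrable_id_mul_of_sq hg.integrable hg.finite_energy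
  have mρ := hg.integrable_density.1.aemeasurable
  have mj : AEMeasurable fun x => ∫ v, v * g x v := hg1.integral_prod_left.1.aemeasurable
  have mu : AEMeasurable (bulkVelocity g) := mj.div mρ
  have mθ : AEMeasurable (localTemperature g) :=
    (hg.integrable_pressure.1.aemeasurable.div mρ).sub (mu.pow_const 2)
  have hθ : ∀ᵐ x, 0 < localTemperature g x := hreg.mono fun x hx => hx.temp_pos
  have hτ0 : ∀ᵐ x, 0 < τ x := ae_of_all _ fun x => h₁.trans_le (hτ.mem x).1
  have a1 := integrable_mul_maxwellian hg.integrable_density mu mθ hθ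
  have a2 := hτ.integrable_part h₁ hg.integrable_density
  have b1 := integrable_sq_mul_mul_maxwellian hg.integrable_density.1 mu mθ hθ
    (hg.integrable_pressure.congr (hreg.mono fun x hx => hx.pressure.symm))
  have b2 := integrable_sq_mul_mul_maxwellian (u := fun _ => 0) hg.integrable_density.1
    aemeasurable_const hτ.measurable.aemeasurable hτ0
    (by simpa using hτ.integrable_mul h₁ hg.integrable_density)
  constructor
  · refine ((a1.const_mul α).add (a2.const_mul (1 - α))).congr (ae_of_all _ fun p => ?_)
    simp only [Pi.add_apply, collisionGain]; ring
  · refine ((b1.const_mul α).add (b2.const_mul (1 - α))).congr (ae_of_all _ fun p => ?_)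
    simp only [Pi.add_apply, collisionGain]; ring

/-- Steady states with bounded temperature profile are determined by their density, which is
invariant under `next κ α τ`. -/
lemma IsSteadyState.identification {g : UnitAddCircle → ℝ → ℝ} (hg : IsSteadyState κ α τ g)
    (hκ : 0 < κ) (hα : α ≠ 1) (h₁ : 0 < τ₁) (hT₁ : 0 < T₁) (hτ : Thermostat τ₁ τ₂ τ)
    (hT : ∀ᵐ x, T₁ ≤ temperatureProfile g x ∧ temperatureProfile g x ≤ T₂) :
    Admissible τ T₁ T₂ (density g) ∧
    (∀ᵐ x, next κ α τ (density g) x = density g x) ∧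
    ∀ᵐ p : UnitAddCircle × ℝ, g p.1 p.2 = mild κ (src α τ (density g)) p.1 p.2 := by
  have hreg := hg.ae_regularAt hT₁ hT
  have hg1 := integrable_id_mul_of_sq hg.integrable hg.finite_energy
  obtain ⟨iq, iq2⟩ := hg.integrable_collisionGain hreg hτ h₁
  have hτ0 : ∀ x, 0 < τ x := fun x => h₁.trans_le (hτ.mem x).1
  have hmode : ModeEq κ g (collisionGain α τ g) :=
    modeEq_of_weak hκ hg.integrable hg1 iq hg.weak_eq
  -- The bulk velocity is not yet known to vanish; the gain term retains the fraction `β = α` of the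
  -- momentum.
  obtain ⟨hj, hP⟩ := hmode.flux_pressure hκ hg.integrable hg.finite_energy iq iq2
    (hreg.mono fun x hx => hx.integral_collisionGain (hτ0 x)) hα
    (hreg.mono fun x hx => hx.integral_id_collisionGain (hτ0 x))
  have hP' : ∀ᵐ x, pressure g x = ∫ y, density g y * τ y := by
    set P := ∫ y, ∫ v, v ^ 2 * collisionGain α τ g y v
    -- Energy balance: the local Maxwellian reproduces the pressure, so the thermostat alone fixes
    -- its constant value.
    have e1 : P = α * (∫ x, pressure g x) + (1 - α) * ∫ x, density g x * τ x := by
      have e : P = ∫ x, (α * pressure g x + (1 - α) * (density g x * τ x)) :=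
        integral_congr_ae (hreg.mono fun x hx => hx.integral_sq_collisionGain (hτ0 x))
      rw [e, integral_add (hg.integrable_pressure.const_mul _)
        ((hτ.integrable_mul h₁ hg.integrable_density).const_mul _), integral_const_mul,
        integral_const_mul]
    have e2 : ∫ x, pressure g x = P := by
      have e : ∫ x, pressure g x = ∫ _ : UnitAddCircle, P := integral_congr_ae hP
      rw [e, integral_const, probReal_univ, one_smul]
    have e3 : (1 - α) * (P - ∫ x, density g x * τ x) = 0 := by
      rw [e2] at e1; linarith
    have e4 : P = ∫ x, density g x * τ x :=
      sub_eq_zero.1 ((mul_eq_zero.1 e3).resolve_left (sub_ne_zero.2 hα.symm))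
    rw [← e4]
    exact hP
  have htemp : ∀ᵐ x, temp τ (density g) x = temperatureProfile g x := by
    filter_upwards [hP'] with x hx
    rw [temperatureProfile, hx, temp]
  have hadm : Admissible τ T₁ T₂ (density g) := by
    refine ⟨hg.integrable_density, hreg.mono fun x hx => hx.density_pos.le, ?_, ?_⟩
    · exact (integral_prod _ hg.integrable).symm.trans hg.mass_one
    · filter_upwards [htemp, hT] with x hx hx'
      rw [hx]
      exact hx'
  have hsrc : ∀ᵐ x, ∀ v, collisionGain α τ g x v = src α τ (density g) x v := by
    filter_upwards [hj, htemp] with x hx hx'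
    intro v
    have hu : bulkVelocity g x = 0 := by rw [bulkVelocity, hx, zero_div]
    have hθ : localTemperature g x = temp τ (density g) x := by
      rw [localTemperature, hu, hx', temperatureProfile]; ring
    rw [collisionGain, hu, hθ, src]
  have hmode' : ModeEq κ g (src α τ (density g)) := by
    intro n
    filter_upwards [hmode n] with v hv
    rw [← hv]
    exact integral_congr_ae (hsrc.mono fun x hx => by simp only [hx v])
  have s := hadm.integrable_src (α := α) hT₁ hτ h₁
  have heq := hmode'.unique hg.integrable (integrable_mild hκ s) (modeEq_mild hκ s)
  refine ⟨hadm, ?_, heq⟩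
  have hsec : ∀ᵐ x, ∀ᵐ v, g x v = mild κ (src α τ (density g)) x v :=
    Measure.ae_ae_of_ae_prod heq
  filter_upwards [hsec] with x hx
  exact (integral_congr_ae hx).symm

/-- The invariant density is unique. -/
lemma fixed_density_unique (hκ : 0 < κ) (h₁ : 0 < τ₁) (h₁₂ : τ₁ ≤ τ₂) (hα : Small κ τ₁ τ₂ α)
    (hτ : Thermostat τ₁ τ₂ τ) (h : Admissible τ (tempLower κ τ₁) (tempUpper κ τ₁ τ₂) ρ)
    (h' : Admissible τ (tempLower κ τ₁) (tempUpper κ τ₁ τ₂) ρ')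
    (hfix : ∀ᵐ x, next κ α τ ρ x = ρ x) (hfix' : ∀ᵐ x, next κ α τ ρ' x = ρ' x) :
    ∀ᵐ x, ρ x = ρ' x := by
  have hT := ((tempLower_le hκ h₁).trans h₁₂).trans (le_tempUpper (κ := κ) h₁ h₁₂)
  have hle := integral_abs_next_sub_le hκ hα.nonneg (hα.le_half.trans (by norm_num)) hτ h₁ h₁₂
    (tempLower_pos hκ h₁) hT h h'
  have e : ∫ x, |next κ α τ ρ x - next κ α τ ρ' x| = ∫ x, |ρ x - ρ' x| := by
    refine integral_congr_ae ?_
    filter_upwards [hfix, hfix'] with x hx hx'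
    rw [hx, hx']
  rw [e] at hle
  have hi : Integrable fun x => |ρ x - ρ' x| := (h.integrable.sub h'.integrable).abs
  have hD : 0 ≤ ∫ x, |ρ x - ρ' x| := integral_nonneg fun _ => abs_nonneg _
  have hc := doeblin_pos (κ := κ) h₁ h₁₂
  have h0 : ∫ x, |ρ x - ρ' x| = 0 := by
    have := mul_le_mul_of_nonneg_right hα.lip hD
    nlinarith
  rw [integral_eq_zero_iff_of_nonneg (fun _ => abs_nonneg _) hi] at h0
  exact h0.mono fun x hx => sub_eq_zero.1 (abs_eq_zero.1 hx)

lemma mild_src_congr (h : ∀ᵐ x, ρ x = ρ' x) (x : UnitAddCircle) (v : ℝ) :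
    mild κ (src α τ ρ) x v = mild κ (src α τ ρ') x v := by
  refine mild_congr κ (h.mono fun y hy => ?_) x
  have hP : ∫ y, ρ y * τ y = ∫ y, ρ' y * τ y :=
    integral_congr_ae (h.mono fun y hy => by simp only [hy])
  rw [src, src, temp, temp, hP, hy]

end Uniqueness

end BGK

/-! ### The main theorem -/

theorem theorem1 (κ : ℝ) (hκ : 0 < κ) :
    ∃ τ₀ : ℝ, 0 < τ₀ ∧ ∀ τlow τbar : ℝ, τ₀ ≤ τlow → τlow ≤ τbar →
      ∃ α₀ : ℝ, 0 < α₀ ∧ α₀ ≤ 1 ∧ ∀ α : ℝ, 0 ≤ α → α ≤ α₀ →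
        ∃ Tlow Tbar : ℝ, 0 < Tlow ∧ Tlow ≤ Tbar ∧
          ∀ τ : UnitAddCircle → ℝ, Measurable τ → (∀ x, τlow ≤ τ x ∧ τ x ≤ τbar) →
            ∃ g : UnitAddCircle → ℝ → ℝ,
              BGK.IsSteadyState κ α τ g ∧
              (∀ x, Tlow ≤ BGK.temperatureProfile g x ∧ BGK.temperatureProfile g x ≤ Tbar) ∧
              ∀ h : UnitAddCircle → ℝ → ℝ, BGK.IsSteadyState κ α τ h →
                (∀ᵐ x, Tlow ≤ BGK.temperatureProfile h x ∧
                  BGK.temperatureProfile h x ≤ Tbar) →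
                ∀ᵐ p : UnitAddCircle × ℝ, h p.1 p.2 = g p.1 p.2 := by
  -- The value `1` is arbitrary: only `0 < τ₁` is used below, since smallness is demanded of `α`
  -- instead.
  refine ⟨1, one_pos, fun τ₁ τ₂ hτ₁ h₁₂ => ?_⟩
  have h₁ : 0 < τ₁ := one_pos.trans_le hτ₁
  obtain ⟨α₀, hα₀, hα₀', hsmall⟩ := BGK.exists_small hκ h₁ h₁₂
  refine ⟨α₀, hα₀, hα₀', fun α hα hαle => ?_⟩
  have hs := hsmall α hα hαle
  have hα1 : α < 1 := hs.le_half.trans_lt (by norm_num)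
  have hT₁ := BGK.tempLower_pos (τ₁ := τ₁) hκ h₁
  have hle := BGK.tempLower_le (τ₁ := τ₁) hκ h₁
  have hle' := h₁₂.trans (BGK.le_tempUpper (κ := κ) h₁ h₁₂)
  refine ⟨BGK.tempLower κ τ₁, BGK.tempUpper κ τ₁ τ₂, hT₁, hle.trans hle', fun τ hτm hτb => ?_⟩
  have hτ : BGK.Thermostat τ₁ τ₂ τ := ⟨hτm, hτb⟩
  obtain ⟨ρ, hρ, hfix⟩ := BGK.exists_fixed_density hκ h₁ h₁₂ hs hτ
  obtain ⟨g, hg, hgT, hgeq⟩ :=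
    BGK.exists_steadyState hκ hα hα1.le h₁ hT₁ hle hle' hτ hρ hfix
  refine ⟨g, hg, hgT, fun h hh hhT => ?_⟩
  obtain ⟨hadm, hfix', heq⟩ := hh.identification hκ hα1.ne h₁ hT₁ hτ hhT
  have hρρ := BGK.fixed_density_unique hκ h₁ h₁₂ hs hτ hadm hρ hfix' hfix
  filter_upwards [heq, hgeq] with p h1 h2
  rw [h1, h2]
  exact BGK.mild_src_congr hρρ p.1 p.2
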